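/- Let $E_1,\dots,E_M$ be Hermitian operators on the Hilbert space $(\mathbb C^2)^{\otimes N}$ of $N$ qubits with operator norm $\|E_a\|\le 1$. Assume that they are traceless and orthonormal for the normalized Hilbert–Schmidt inner product, i.e. $\operatorname{Tr}E_a=0$ and $\operatorname{Tr}(E_aE_b)=2^N\delta_{ab}$ for all $a,b$ (for example, distinct non-identity tensor products of Pauli matrices). The support of an operator $P$ is the smallest set $S$ of qubits such that $P=O\otimes I$ with $O$ acting on the qubits in $S$. Let $\mathfrak d$ be the maximum degree of the dual interaction graph, the graph with vertices $1,\dots,M$ in which $a\ne b$ are adjacent if and only if the supports of $E_a$ and $E_b$ intersect. Let $\beta>0$ satisfy $$100\,e^6(\mathfrak d+1)^8\beta\le 1,$$ and for $\lambda\in\mathbb R^M$ let $$F(\lambda)=\log\operatorname{Tr}\exp\Bigl(-\beta\sum_{a=1}^M\lambda_aE_a\Bigr)$$ be the log-partition function. Then: 1. $F$ is twice continuously differentiable on $\mathbb R^M$, and it is $\frac{\beta^2}{2}$-strongly convex on $[-1,1]^M$ (with respect to the Euclidean norm). 2. For every $\lambda\in[-1,1]^M$ the Hessian matrix $\nabla^2F(\lambda)=(\partial_a\partial_bF(\lambda))_{a,b}$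 satisfies $$\frac{\beta^2}{2}I\preceq\nabla^2F(\lambda)\preceq\frac{3\beta^2}{2}I .$$ 3. The strong convexity constant is optimal up to a factor $3$: if $M\ge 1$ and $F$ is $m$-strongly convex on $[-1,1]^M$, then $m\le 3\cdot\frac{\beta^2}{2}$. -/

import Mathlib

open scoped Matrix

/-- Computational basis states of `N` qubits. -/
abbrev QubitBasis (N : ℕ) : Type := Fin N → Fin 2

/-- Operators on the Hilbert space `(ℂ²)^{⊗N}` of `N` qubits, of dimension `2 ^ N`. -/
abbrev QubitOp (N : ℕ) : Type := Matrix (QubitBasis N) (QubitBasis N) ℂ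

/-- `P = O ⊗ I`, where `O` acts on the qubits in `S` and `I` is the identity on the other qubits. -/
def ActsOnlyOn {N : ℕ} (P : QubitOp N) (S : Finset (Fin N)) : Prop :=
  ∃ O : Matrix (S → Fin 2) (S → Fin 2) ℂ, ∀ x y : QubitBasis N,
    ((∀ i, i ∉ S → x i = y i) → P x y = O (fun i => x i) (fun i => y i)) ∧
    ((∃ i, i ∉ S ∧ x i ≠ y i) → P x y = 0)

open Classical in
/-- The support of `P`: the least set `S` of qubits such that `P = O ⊗ I` with `O` acting on `S`.
It is defined as the intersection of all these sets; `actsOnlyOn_qubitSupport` shows that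
this intersection is one of them. -/
noncomputable def qubitSupport {N : ℕ} (P : QubitOp N) : Finset (Fin N) :=
  Finset.univ.filter fun i => ∀ S : Finset (Fin N), ActsOnlyOn P S → i ∈ S

theorem actsOnlyOn_univ {N : ℕ} (P : QubitOp N) : ActsOnlyOn P Finset.univ :=
  ⟨fun u v => P (fun i => u ⟨i, Finset.mem_univ i⟩) (fun i => v ⟨i, Finset.mem_univ i⟩),
    fun _ _ => ⟨fun _ => rfl, fun ⟨i, hi, _⟩ => absurd (Finset.mem_univ i) hi⟩⟩

theorem ActsOnlyOn.inter {N : ℕ} {P : QubitOp N} {S T : Finset (Fin N)}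
    (hS : ActsOnlyOn P S) (hT : ActsOnlyOn P T) : ActsOnlyOn P (S ∩ T) := by
  obtain ⟨O, hO⟩ := hS
  obtain ⟨Q, hQ⟩ := hT
  refine ⟨fun u v => P (fun i => if h : i ∈ S ∩ T then u ⟨i, h⟩ else 0)
    (fun i => if h : i ∈ S ∩ T then v ⟨i, h⟩ else 0), fun x y => ⟨fun h => ?_, ?_⟩⟩
  · have h1 : P x y = P (fun i => if i ∈ S then x i else 0) (fun i => if i ∈ S then y i else 0) := by
      by_cases hxy : ∀ i, i ∉ S → x i = y i
      · rw [(hO x y).1 hxy, (hO _ _).1 (by intro i hi; simp [hi])]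
        congr 1 <;> (funext i; simp)
      · exact absurd (fun i hi => h i (by simp [hi])) hxy
    rw [h1]
    rw [(hQ _ _).1 (by
      intro i hi
      by_cases hiS : i ∈ S
      · simp [hiS, h i (by simp [hi])]
      · simp [hiS])]
    refine Eq.trans ?_ ((hQ _ _).1 (by
      intro i hi
      simp [hi])).symm
    congr 1 <;> (funext i; simp)
  · rintro ⟨i, hi, hne⟩
    by_cases hiS : i ∈ S
    · exact (hQ x y).2 ⟨i, fun hiT => hi (Finset.mem_inter.2 ⟨hiS, hiT⟩), hne⟩
    · exact (hO x y).2 ⟨i, hiS, hne⟩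

theorem actsOnlyOn_qubitSupport {N : ℕ} (P : QubitOp N) : ActsOnlyOn P (qubitSupport P) := by
  classical
  have key : ∀ F : Finset (Finset (Fin N)), (∀ S ∈ F, ActsOnlyOn P S) →
      ActsOnlyOn P (F.inf id) := by
    intro F
    induction F using Finset.induction_on with
    | empty => intro _; exact actsOnlyOn_univ P
    | insert S F _ ih =>
      intro hF
      rw [Finset.inf_insert]
      exact (hF S (Finset.mem_insert_self _ _)).inter
        (ih fun T hT => hF T (Finset.mem_insert_of_mem hT))
  have h := key (Finset.univ.filter fun S => ActsOnlyOn P S) (by simp)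
  have e : (Finset.univ.filter fun S => ActsOnlyOn P S).inf id = qubitSupport P := by
    ext i
    simp [qubitSupport, Finset.mem_inf]
  rwa [e] at h

/-- The terms of a Hamiltonian on `N` qubits: a finite family of Hermitian operators of
operator norm at most one. -/
structure HamiltonianTerms (N : ℕ) (ι : Type*) where
  /-- The term with index `a`. -/
  E : ι → QubitOp N
  isHermitian : ∀ a, (E a).IsHermitian
  norm_le_one : ∀ a, ‖Matrix.toEuclideanCLM (𝕜 := ℂ) (E a)‖ ≤ 1

namespace HamiltonianTerms

/-- Every term is traceless, and the terms are orthonormal for the normalized Hilbert–Schmidt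
inner product `⟨A, B⟩ = Tr (A† B) / 2 ^ N`. -/
def TracelessOrthonormal {N : ℕ} {ι : Type*} (T : HamiltonianTerms N ι) : Prop :=
  (∀ a, (T.E a).trace = 0) ∧
  (∀ a, ((T.E a)ᴴ * T.E a).trace = 2 ^ N) ∧
  (∀ a b, a ≠ b → ((T.E a)ᴴ * T.E b).trace = 0)

/-- The dual interaction graph: distinct terms are joined when their supports intersect. -/
def dualInteractionGraph {N : ℕ} {ι : Type*} (T : HamiltonianTerms N ι) : SimpleGraph ι where
  Adj a b := a ≠ b ∧ (qubitSupport (T.E a) ∩ qubitSupport (T.E b)).Nonempty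
  symm := ⟨fun _ _ h => ⟨h.1.symm, by rw [Finset.inter_comm]; exact h.2⟩⟩
  loopless := ⟨fun _ h => h.1 rfl⟩

open Classical in
/-- The maximum degree of the dual interaction graph. -/
noncomputable def dualDegree {N : ℕ} {ι : Type*} [Fintype ι] (T : HamiltonianTerms N ι) : ℕ :=
  T.dualInteractionGraph.maxDegree

/-- The Hamiltonian `H = ∑ a, x a • E a` with coefficient vector `x`. -/
noncomputable def hamiltonian {N : ℕ} {ι : Type*} [Fintype ι] (T : HamiltonianTerms N ι)
    (x : EuclideanSpace ℝ ι) : QubitOp N :=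
  ∑ a, (x a : ℂ) • T.E a

/-- The partition function `Tr exp (-β H)`, a positive real number. -/
noncomputable def partitionFunction {N : ℕ} {ι : Type*} [Fintype ι] (T : HamiltonianTerms N ι)
    (β : ℝ) (x : EuclideanSpace ℝ ι) : ℝ :=
  (NormedSpace.exp ((-β : ℂ) • T.hamiltonian x)).trace.re

theorem isHermitian_smul_hamiltonian {N : ℕ} {ι : Type*} [Fintype ι] (T : HamiltonianTerms N ι)
    (β : ℝ) (x : EuclideanSpace ℝ ι) : ((-β : ℂ) • T.hamiltonian x).IsHermitian := by
  unfold Matrix.IsHermitian hamiltonian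
  rw [Matrix.conjTranspose_smul, Matrix.conjTranspose_sum]
  simp [Matrix.conjTranspose_smul, (T.isHermitian _).eq]

open scoped ComplexOrder in
theorem posDef_exp {N : ℕ} {ι : Type*} [Fintype ι] (T : HamiltonianTerms N ι)
    (β : ℝ) (x : EuclideanSpace ℝ ι) :
    (NormedSpace.exp ((-β : ℂ) • T.hamiltonian x)).PosDef := by
  have h := T.isHermitian_smul_hamiltonian (β / 2) x
  have e : (-β : ℂ) • T.hamiltonian x
      = (-(β / 2 : ℝ) : ℂ) • T.hamiltonian x + (-(β / 2 : ℝ) : ℂ) • T.hamiltonian x := by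
    rw [← add_smul]; congr 1; push_cast; ring
  rw [e, Matrix.exp_add_of_commute _ _ (Commute.refl _)]
  nth_rewrite 1 [← h.exp.eq]
  refine Matrix.PosDef.conjTranspose_mul_self _ ?_
  exact Matrix.mulVec_injective_of_isUnit (Matrix.isUnit_exp _)

open scoped ComplexOrder in
theorem partitionFunction_pos {N : ℕ} {ι : Type*} [Fintype ι] (T : HamiltonianTerms N ι)
    (β : ℝ) (x : EuclideanSpace ℝ ι) : 0 < T.partitionFunction β x :=
  (Complex.pos_iff.1 (T.posDef_exp β x).trace_pos).1

open scoped ComplexOrder in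
theorem ofReal_partitionFunction {N : ℕ} {ι : Type*} [Fintype ι] (T : HamiltonianTerms N ι)
    (β : ℝ) (x : EuclideanSpace ℝ ι) :
    (T.partitionFunction β x : ℂ) = (NormedSpace.exp ((-β : ℂ) • T.hamiltonian x)).trace :=
  Complex.ext (by simp [partitionFunction])
    (by simpa using (Complex.pos_iff.1 (T.posDef_exp β x).trace_pos).2)

/-- The log-partition function `log Tr exp (-β H)`, as a function of the coefficients. -/
noncomputable def logPartition {N : ℕ} {ι : Type*} [Fintype ι] (T : HamiltonianTerms N ι)
    (β : ℝ) (x : EuclideanSpace ℝ ι) : ℝ :=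
  Real.log (T.partitionFunction β x)

end HamiltonianTerms

/-- The set `[-1,1]^ι` of admissible coefficient vectors. -/
def coefficientCube (ι : Type*) : Set (EuclideanSpace ℝ ι) :=
  {x | ∀ a, x a ∈ Set.Icc (-1 : ℝ) 1}

/-- The Hessian matrix of `f` at `x`, with entries the second partial derivatives `∂_a ∂_b f x`. -/
noncomputable def hessianMatrix {ι : Type*} [DecidableEq ι] [Fintype ι] (f : EuclideanSpace ℝ ι → ℝ)
    (x : EuclideanSpace ℝ ι) : Matrix ι ι ℝ :=
  Matrix.of fun a b =>
    lineDeriv ℝ (fun y => lineDeriv ℝ f y (EuclideanSpace.single b 1)) x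
      (EuclideanSpace.single a 1)

/-!
At high temperature the log-partition function is, up to a constant, a small perturbation of
`β² |λ|² / 2`, whose Hessian is `β²` times the identity. The size of the perturbation is read off
from a zero-free polydisc of the partition function, by Cauchy estimates.

Let `Z(x) = 2⁻ᴺ Tr exp (∑ a, x a • E a)` for complex `x`, and let `d` be the degree of the dual
interaction graph. Expand the exponential into words in the letters `x a • E a` and collect the
words by the set `C` of letters that occur in them. This writes the partition function of any set
`S` of terms as the sum of weights `φ C` over `C ⊆ S`, with `‖φ C‖ ≤ (e^r - 1) ^ |C|` when all
`‖x a‖ ≤ r` (`norm_expWordSum_le`). The partition function of a union of two sets of terms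
factorizes when no term of one set shares a qubit with a term of the other
(`normTrace_exp_sum_add_sum`). These two facts suffice for an induction
(`norm_clusterSum_le`) which explores the cluster of a given term neighbour by neighbour. No
connected sets have to be counted, since the induction compares partition functions of smaller and
smaller sets of terms. It shows that `Z` has no zeros for `‖x a‖ ≤ 1 / (4 (d + 1)²)`, and that
dropping one term changes `Z` by a factor at distance at most `1 / (3 (d + 1))` from `1`
(`HamiltonianTerms.complexPartition_univ_ne_zero`). By the Cauchy estimate, the logarithmic
derivatives `G_b = ∂_b Z / Z` are bounded by `4 (d + 1)` on half of this polydisc.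

The Hessian of the log-partition function at `λ` has the entries `β² ∂_a G_b (-β λ)`. At `0`
the matrix `∂_a G_b` is the identity, by orthonormality. For a vector `θ` of signs, the function
`t ↦ G_b (x + t θ) - G_b (t θ)` is `O(β)` by the Schwarz lemma along the ray to `x = -β λ`, so
that its derivative at `0` is `O(β)` as well. For the right signs this derivative is the sum
`∑ a, |∂_a G_b (x) - δ_ab|`, which is therefore at most `1 / 2`
(`HamiltonianTerms.sum_abs_re_fderiv_logDerivPartition_le`). Thus no decay of
correlations is needed: the bound for a whole row of the Hessian comes from a single Cauchy
estimate in the supremum norm. The Schur test turns the row sums into bounds for the quadratic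
form, which give the semidefinite bounds and, along segments, strong convexity and its optimality.
-/

/-! ### Cluster sums of polymer weights -/

section PolymerBound

variable {ι : Type*} [DecidableEq ι]

/-- The sum of the weights `φ U` over the sets `U` with `C ⊆ U ⊆ C ∪ B`, for disjoint `C` and `B`.
For `C = ∅` this is the partition function of the polymer weights `φ` on `B`. -/
def clusterSum (φ : Finset ι → ℂ) (C B : Finset ι) : ℂ :=
  ∑ T ∈ B.powerset, φ (C ∪ T)

theorem clusterSum_insert_left (φ : Finset ι → ℂ) {C B : Finset ι} {b : ι} (hb : b ∉ B) :
    clusterSum φ C (insert b B) = clusterSum φ C B + clusterSum φ (insert b C) B := by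
  unfold clusterSum
  rw [Finset.sum_powerset_insert hb]
  congr 1
  refine Finset.sum_congr rfl fun T _ => ?_
  rw [Finset.insert_union, Finset.union_insert]

theorem clusterSum_empty_right (φ : Finset ι → ℂ) (C : Finset ι) : clusterSum φ C ∅ = φ C := by
  simp [clusterSum]

/-- Factorization of the partition functions of mutually independent regions passes to all
cluster sums, since these are iterated differences of partition functions. -/
theorem clusterSum_union {φ : Finset ι → ℂ} {nbr : ι → Finset ι}
    (hf : ∀ D R : Finset ι, Disjoint D R → (∀ d ∈ D, ∀ r ∈ R, r ∉ nbr d) →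
      clusterSum φ ∅ (D ∪ R) = clusterSum φ ∅ D * clusterSum φ ∅ R)
    (C : Finset ι) : ∀ B R : Finset ι, Disjoint C B → Disjoint (C ∪ B) R →
      (∀ d ∈ C ∪ B, ∀ r ∈ R, r ∉ nbr d) →
      clusterSum φ C (B ∪ R) = clusterSum φ C B * clusterSum φ ∅ R := by
  induction C using Finset.induction_on with
  | empty =>
    intro B R _ h1 h2
    rw [Finset.empty_union] at h1 h2
    exact hf B R h1 h2
  | insert b C hbC ih =>
    intro B R hCB hR hadj
    obtain ⟨hbB, hCB⟩ := Finset.disjoint_insert_left.1 hCB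
    have hbR : b ∉ R := fun h =>
      Finset.disjoint_left.1 hR (Finset.mem_union_left _ (Finset.mem_insert_self _ _)) h
    have h1 := clusterSum_insert_left φ (C := C) (B := B ∪ R) (b := b) (by simp [hbB, hbR])
    have h2 := clusterSum_insert_left φ (C := C) (B := B) (b := b) hbB
    have e : C ∪ insert b B = insert b C ∪ B := by
      rw [Finset.union_insert, Finset.insert_union]
    have h3 := ih (insert b B) R (Finset.disjoint_insert_right.2 ⟨hbC, hCB⟩)
      (by rwa [e]) (by rwa [e])
    have hsub : C ∪ B ⊆ insert b C ∪ B :=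
      Finset.union_subset_union_left (Finset.subset_insert _ _)
    have h4 := ih B R hCB (hR.mono_left hsub) fun d hd => hadj d (hsub hd)
    rw [Finset.insert_union] at h3
    linear_combination h3 - h4 - h1 + h2 * clusterSum φ ∅ R

/-- The main estimate. Here `A` holds the elements of `B` that may be adjacent to `C`: each of
them costs a factor `κ`, and each element of `C` a factor `w`. An element `b` of `A` is either
dropped, or moved to `C`, in which case its neighbours join `A`; when `A` is empty, the cluster
sum factorizes. -/
theorem norm_clusterSum_le {φ : Finset ι → ℂ} {nbr : ι → Finset ι} {d : ℕ}
    {w κ η : ℝ}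
    (hf : ∀ D R : Finset ι, Disjoint D R → (∀ d ∈ D, ∀ r ∈ R, r ∉ nbr d) →
      clusterSum φ ∅ (D ∪ R) = clusterSum φ ∅ D * clusterSum φ ∅ R)
    (hφ : ∀ C, ‖φ C‖ ≤ w ^ C.card)
    (hd : ∀ a, (nbr a).card ≤ d)
    (hw : 0 ≤ w) (hκ1 : 1 ≤ κ) (hη : w * κ ^ d ≤ η) (hκ : 1 + η ≤ κ * (1 - η))
    (B : Finset ι) : ∀ C A : Finset ι, Disjoint C B → A ⊆ B →
      (∀ c ∈ C, ∀ r ∈ B \ A, r ∉ nbr c) →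
      ‖clusterSum φ C B‖ ≤ w ^ C.card * κ ^ A.card * ‖clusterSum φ ∅ B‖ := by
  have hκ0 : 0 ≤ κ := zero_le_one.trans hκ1
  induction B using Finset.strongInduction with
  | H B ih =>
    intro C A hCB hAB hadj
    rcases A.eq_empty_or_nonempty with rfl | ⟨b, hbA⟩
    · have h := clusterSum_union hf C ∅ B (Finset.disjoint_empty_right _) (by simpa using hCB)
        (by simpa using hadj)
      rw [Finset.empty_union, clusterSum_empty_right] at h
      rw [h, norm_mul]
      simpa using mul_le_mul_of_nonneg_right (hφ C) (norm_nonneg (clusterSum φ ∅ B))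
    · have hbB := hAB hbA
      have hbE : b ∉ B.erase b := Finset.notMem_erase _ _
      have hss := Finset.erase_ssubset hbB
      have hCE : Disjoint C (B.erase b) := hCB.mono_right (Finset.erase_subset _ _)
      have hbC : b ∉ C := fun h => Finset.disjoint_left.1 hCB h hbB
      have hrec := fun C' => clusterSum_insert_left φ (C := C') hbE
      simp only [Finset.insert_erase hbB] at hrec
      have hpos : 0 ≤ ‖clusterSum φ ∅ (B.erase b)‖ := norm_nonneg _
      -- the partition function changes by a factor in `[1 - η, 1 + η]` when `b` is dropped
      have hratio : (1 - η) * ‖clusterSum φ ∅ (B.erase b)‖ ≤ ‖clusterSum φ ∅ B‖ := by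
        have h1 := ih _ hss {b} (nbr b ∩ B.erase b) (by simp) Finset.inter_subset_right (by
          intro c hc r hr hcr
          rw [Finset.mem_singleton] at hc
          subst hc
          simp only [Finset.mem_sdiff, Finset.mem_inter] at hr
          exact hr.2 ⟨hcr, hr.1⟩)
        have h2 : κ ^ (nbr b ∩ B.erase b).card ≤ κ ^ d :=
          pow_le_pow_right₀ hκ1 ((Finset.card_le_card Finset.inter_subset_left).trans (hd b))
        have h3 := hrec ∅
        rw [insert_empty_eq] at h3
        have h4 : ‖clusterSum φ {b} (B.erase b)‖ ≤ η * ‖clusterSum φ ∅ (B.erase b)‖ := by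
          refine h1.trans (mul_le_mul_of_nonneg_right ?_ hpos)
          rw [Finset.card_singleton, pow_one]
          exact (mul_le_mul_of_nonneg_left h2 hw).trans hη
        have h5 := norm_sub_le (clusterSum φ ∅ B) (clusterSum φ {b} (B.erase b))
        rw [h3, add_sub_cancel_right, ← h3] at h5
        linarith
      have hdrop := ih _ hss C (A.erase b) hCE (Finset.erase_subset_erase _ hAB) (by
        intro c hc r hr
        refine hadj c hc r ?_
        simp only [Finset.mem_sdiff, Finset.mem_erase] at hr ⊢
        exact ⟨hr.1.2, fun h => hr.2 ⟨hr.1.1, h⟩⟩)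
      have hmove := ih _ hss (insert b C) (A.erase b ∪ (nbr b ∩ B.erase b))
        (Finset.disjoint_insert_left.2 ⟨hbE, hCE⟩)
        (Finset.union_subset (Finset.erase_subset_erase _ hAB) Finset.inter_subset_right) (by
        intro c hc r hr hcr
        simp only [Finset.mem_sdiff, Finset.mem_erase, Finset.mem_union, Finset.mem_inter,
          not_or, not_and] at hr
        rcases Finset.mem_insert.1 hc with rfl | hc
        · exact hr.2.2 (hcr) hr.1.1 hr.1.2
        · exact hadj c hc r (Finset.mem_sdiff.2 ⟨hr.1.2, hr.2.1 hr.1.1⟩) hcr)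
      rw [Finset.card_insert_of_notMem hbC] at hmove
      have hcard : κ ^ (A.erase b ∪ (nbr b ∩ B.erase b)).card ≤ κ ^ (A.erase b).card * κ ^ d := by
        rw [← pow_add]
        refine pow_le_pow_right₀ hκ1 ((Finset.card_union_le _ _).trans ?_)
        exact Nat.add_le_add_left
          ((Finset.card_le_card Finset.inter_subset_left).trans (hd b)) _
      have hA : A.card = (A.erase b).card + 1 := (Finset.card_erase_add_one hbA).symm
      set a := (A.erase b).card
      set Z := ‖clusterSum φ ∅ (B.erase b)‖
      have hwC : 0 ≤ w ^ C.card := pow_nonneg hw _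
      have hκa : 0 ≤ κ ^ a := pow_nonneg hκ0 _
      have hη0 : 0 ≤ η := le_trans (by positivity) hη
      have hmove' : ‖clusterSum φ (insert b C) (B.erase b)‖ ≤ w ^ C.card * κ ^ a * (η * Z) := by
        refine hmove.trans ?_
        calc w ^ (C.card + 1) * κ ^ (A.erase b ∪ (nbr b ∩ B.erase b)).card * Z
            ≤ w ^ (C.card + 1) * (κ ^ a * κ ^ d) * Z := by gcongr
          _ = w ^ C.card * κ ^ a * ((w * κ ^ d) * Z) := by ring
          _ ≤ w ^ C.card * κ ^ a * (η * Z) := by gcongr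
      calc ‖clusterSum φ C B‖
          ≤ w ^ C.card * κ ^ a * Z + w ^ C.card * κ ^ a * (η * Z) := by
            rw [hrec C]
            exact (norm_add_le _ _).trans (add_le_add hdrop hmove')
        _ = w ^ C.card * κ ^ a * ((1 + η) * Z) := by ring
        _ ≤ w ^ C.card * κ ^ a * (κ * (1 - η) * Z) := by gcongr
        _ = w ^ C.card * κ ^ a * κ * ((1 - η) * Z) := by ring
        _ ≤ w ^ C.card * κ ^ a * κ * ‖clusterSum φ ∅ B‖ := by gcongr
        _ = w ^ C.card * κ ^ A.card * ‖clusterSum φ ∅ B‖ := by rw [hA, pow_succ]; ring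

/-- Adding one element changes the partition function by a relative amount of at most `η`. -/
theorem norm_clusterSum_insert_sub_le {φ : Finset ι → ℂ} {nbr : ι → Finset ι} {d : ℕ} {w κ η : ℝ}
    (hf : ∀ D R : Finset ι, Disjoint D R → (∀ d ∈ D, ∀ r ∈ R, r ∉ nbr d) →
      clusterSum φ ∅ (D ∪ R) = clusterSum φ ∅ D * clusterSum φ ∅ R)
    (hφ : ∀ C, ‖φ C‖ ≤ w ^ C.card)
    (hd : ∀ a, (nbr a).card ≤ d)
    (hw : 0 ≤ w) (hκ1 : 1 ≤ κ) (hη : w * κ ^ d ≤ η) (hκ : 1 + η ≤ κ * (1 - η))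
    {b : ι} {B : Finset ι} (hb : b ∉ B) :
    ‖clusterSum φ ∅ (insert b B) - clusterSum φ ∅ B‖ ≤ η * ‖clusterSum φ ∅ B‖ := by
  have h1 := norm_clusterSum_le hf hφ hd hw hκ1 hη hκ B {b} (nbr b ∩ B)
    (by simpa using hb) Finset.inter_subset_right (by
      intro c hc r hr hcr
      rw [Finset.mem_singleton] at hc
      subst hc
      simp only [Finset.mem_sdiff, Finset.mem_inter] at hr
      exact hr.2 ⟨hcr, hr.1⟩)
  have h2 : κ ^ (nbr b ∩ B).card ≤ κ ^ d :=
    pow_le_pow_right₀ hκ1 ((Finset.card_le_card Finset.inter_subset_left).trans (hd b))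
  rw [clusterSum_insert_left φ hb, add_sub_cancel_left, insert_empty_eq]
  refine h1.trans (mul_le_mul_of_nonneg_right ?_ (norm_nonneg _))
  rw [Finset.card_singleton, pow_one]
  exact (mul_le_mul_of_nonneg_left h2 hw).trans hη

theorem clusterSum_ne_zero {φ : Finset ι → ℂ} {η : ℝ} (hη1 : η < 1) (h0 : φ ∅ ≠ 0)
    (h : ∀ b B, b ∉ B →
      ‖clusterSum φ ∅ (insert b B) - clusterSum φ ∅ B‖ ≤ η * ‖clusterSum φ ∅ B‖)
    (B : Finset ι) : clusterSum φ ∅ B ≠ 0 := by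
  induction B using Finset.induction_on with
  | empty => rwa [clusterSum_empty_right]
  | insert b B hb ih =>
    intro h0
    have h1 := h b B hb
    rw [h0, zero_sub, norm_neg] at h1
    have := norm_pos_iff.2 ih
    nlinarith

end PolymerBound

/-! ### Exponentials as sums over words -/

section Words

variable {ι : Type*} [DecidableEq ι]

/-- Möbius inversion on the subset lattice, in the form of uniqueness. -/
theorem Finset.eq_of_forall_sum_powerset_eq {V : Type*} [AddCommGroup V] {g h : Finset ι → V}
    (hgh : ∀ S : Finset ι, ∑ C ∈ S.powerset, g C = ∑ C ∈ S.powerset, h C) (S : Finset ι) :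
    g S = h S := by
  induction S using Finset.strongInduction with
  | H S ih =>
    have h1 := hgh S
    rw [← Finset.sum_erase_add _ _ (Finset.mem_powerset_self S),
      ← Finset.sum_erase_add _ h (Finset.mem_powerset_self S)] at h1
    rw [Finset.sum_congr rfl fun C hC => ih C ?_] at h1
    · exact add_left_cancel h1
    · rw [Finset.mem_erase, Finset.mem_powerset] at hC
      exact hC.2.ssubset_of_ne hC.1

/-- The sum of all words of length `n` in the letters `X c`, `c ∈ C`, in which every letter
occurs. A word is obtained from one that is shorter by one by adding a first letter `c`, which may
or may not occur in the shorter word. -/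
def wordSum {𝔸 : Type*} [Ring 𝔸] (X : ι → 𝔸) : ℕ → Finset ι → 𝔸
  | 0, C => if C = ∅ then 1 else 0
  | n + 1, C => ∑ c ∈ C, X c * (wordSum X n C + wordSum X n (C.erase c))

theorem sum_powerset_wordSum {𝔸 : Type*} [Ring 𝔸] (X : ι → 𝔸) (n : ℕ) (S : Finset ι) :
    ∑ C ∈ S.powerset, wordSum X n C = (∑ c ∈ S, X c) ^ n := by
  induction n generalizing S with
  | zero => simp [wordSum, Finset.sum_ite_eq']
  | succ n ih =>
    have h1 : ∑ C ∈ S.powerset, wordSum X (n + 1) C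
        = ∑ c ∈ S, ∑ C ∈ S.powerset with c ∈ C,
            X c * (wordSum X n C + wordSum X n (C.erase c)) := by
      simp only [wordSum]
      refine Finset.sum_comm' fun C c => ?_
      simp only [Finset.mem_powerset, Finset.mem_filter]
      exact ⟨fun h => ⟨⟨h.1, h.2⟩, h.1 h.2⟩, fun h => ⟨h.1.1, h.1.2⟩⟩
    rw [h1, pow_succ', Finset.sum_mul]
    refine Finset.sum_congr rfl fun c hc => ?_
    rw [← Finset.mul_sum, ← ih S]
    congr 1
    have h2 : S = insert c (S.erase c) := (Finset.insert_erase hc).symm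
    have hce : c ∉ S.erase c := Finset.notMem_erase _ _
    rw [Finset.sum_filter, h2, Finset.sum_powerset_insert hce, Finset.sum_powerset_insert hce,
      ← Finset.sum_add_distrib, ← Finset.sum_add_distrib]
    refine Finset.sum_congr rfl fun T hT => ?_
    have hcT : c ∉ T := fun h => hce (Finset.mem_powerset.1 hT h)
    rw [if_neg hcT, if_pos (Finset.mem_insert_self _ _), Finset.erase_insert hcT, zero_add,
      add_comm]

theorem norm_wordSum_le {𝔸 : Type*} [NormedRing 𝔸] [NormOneClass 𝔸] {X : ι → 𝔸} {x : ι → ℝ}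
    (hX : ∀ c, ‖X c‖ ≤ x c) (n : ℕ) (C : Finset ι) : ‖wordSum X n C‖ ≤ wordSum x n C := by
  induction n generalizing C with
  | zero =>
    by_cases h : C = ∅ <;> simp [wordSum, h]
  | succ n ih =>
    refine (norm_sum_le _ _).trans (Finset.sum_le_sum fun c _ => (norm_mul_le _ _).trans ?_)
    exact mul_le_mul (hX c) ((norm_add_le _ _).trans (add_le_add (ih _) (ih _)))
      (norm_nonneg _) ((norm_nonneg _).trans (hX c))

/-- The part of `exp (∑ c ∈ C, X c)` in which every letter of `C` occurs. -/
noncomputable def expWordSum {𝔸 : Type*} [NormedRing 𝔸] [NormedAlgebra ℂ 𝔸] (X : ι → 𝔸)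
    (C : Finset ι) : 𝔸 :=
  ∑' n : ℕ, ((n.factorial : ℂ)⁻¹) • wordSum X n C

theorem norm_wordSum_le_pow {𝔸 : Type*} [NormedRing 𝔸] [NormOneClass 𝔸] {X : ι → 𝔸} {x : ι → ℝ}
    (hX : ∀ c, ‖X c‖ ≤ x c) (n : ℕ) (C : Finset ι) : ‖wordSum X n C‖ ≤ (∑ c ∈ C, x c) ^ n := by
  refine (norm_wordSum_le hX n C).trans ?_
  rw [← sum_powerset_wordSum]
  refine Finset.single_le_sum (f := wordSum x n) (fun D _ => ?_) (Finset.mem_powerset_self C)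
  exact (norm_nonneg _).trans (norm_wordSum_le hX n D)

theorem hasSum_expWordSum {𝔸 : Type*} [NormedRing 𝔸] [NormOneClass 𝔸] [NormedAlgebra ℂ 𝔸]
    [CompleteSpace 𝔸] (X : ι → 𝔸) (C : Finset ι) :
    HasSum (fun n : ℕ => ((n.factorial : ℂ)⁻¹) • wordSum X n C) (expWordSum X C) := by
  refine Summable.hasSum (Summable.of_norm_bounded
    (Real.summable_pow_div_factorial (∑ c ∈ C, ‖X c‖)) fun n => ?_)
  rw [norm_smul, norm_inv, Complex.norm_natCast, inv_mul_eq_div]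
  gcongr
  exact norm_wordSum_le_pow (fun c => le_rfl) n C

theorem sum_powerset_expWordSum {𝔸 : Type*} [NormedRing 𝔸] [NormOneClass 𝔸] [NormedAlgebra ℂ 𝔸]
    [CompleteSpace 𝔸] (X : ι → 𝔸) (S : Finset ι) :
    ∑ C ∈ S.powerset, expWordSum X C = NormedSpace.exp (∑ c ∈ S, X c) := by
  have h := hasSum_sum (s := S.powerset) fun C _ => hasSum_expWordSum X C
  simp only [← Finset.smul_sum, sum_powerset_wordSum] at h
  exact h.unique (NormedSpace.exp_series_hasSum_exp' _)

/-- The word sums are dominated by those of commuting letters, for which Möbius inversion gives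
a product. -/
theorem norm_expWordSum_le {𝔸 : Type*} [NormedRing 𝔸] [NormOneClass 𝔸] [NormedAlgebra ℂ 𝔸]
    [CompleteSpace 𝔸] {X : ι → 𝔸} {x : ι → ℝ} (hX : ∀ c, ‖X c‖ ≤ x c) (C : Finset ι) :
    ‖expWordSum X C‖ ≤ ∏ c ∈ C, (Real.exp (x c) - 1) := by
  have hx : ∀ n C, ‖wordSum x n C‖ ≤ (∑ c ∈ C, |x c|) ^ n := fun n C =>
    norm_wordSum_le_pow (fun c => le_rfl) n C
  have hs : ∀ C : Finset ι, Summable fun n : ℕ => wordSum x n C / n.factorial := fun C => by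
    refine Summable.of_norm_bounded (Real.summable_pow_div_factorial (∑ c ∈ C, |x c|)) fun n => ?_
    rw [norm_div, Real.norm_natCast]
    gcongr
    exact hx n C
  have key : ∑' n : ℕ, wordSum x n C / n.factorial = ∏ c ∈ C, (Real.exp (x c) - 1) := by
    refine Finset.eq_of_forall_sum_powerset_eq
      (g := fun C => ∑' n : ℕ, wordSum x n C / n.factorial)
      (h := fun C => ∏ c ∈ C, (Real.exp (x c) - 1)) (fun S => ?_) C
    rw [← Finset.prod_add_one, ← Summable.tsum_finsetSum fun C _ => hs C]
    simp only [← Finset.sum_div, sum_powerset_wordSum, sub_add_cancel, ← Real.exp_sum]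
    rw [Real.exp_eq_exp_ℝ, NormedSpace.exp_eq_tsum_div]
  rw [← key]
  refine tsum_of_norm_bounded (hs C).hasSum fun n => ?_
  rw [norm_smul, norm_inv, Complex.norm_natCast, inv_mul_eq_div]
  gcongr
  exact norm_wordSum_le hX n C

end Words

/-! ### Operators on disjoint sets of qubits -/

section Factorization

open scoped Kronecker

/-- The qubits in `S` and the other qubits, as the two factors of the computational basis. -/
def qubitSplit {N : ℕ} (S : Finset (Fin N)) :
    QubitBasis N ≃ ({i // i ∈ S} → Fin 2) × ({i // i ∉ S} → Fin 2) :=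
  Equiv.piEquivPiSubtypeProd (· ∈ S) fun _ => Fin 2

/-- The embedding `O ↦ O ⊗ I` of the operators on the qubits in `S`. -/
def actInside {N : ℕ} (S : Finset (Fin N)) :
    Matrix ({i // i ∈ S} → Fin 2) ({i // i ∈ S} → Fin 2) ℂ →+* QubitOp N where
  toFun O := (O ⊗ₖ (1 : Matrix ({i // i ∉ S} → Fin 2) ({i // i ∉ S} → Fin 2) ℂ)).submatrix
    (qubitSplit S) (qubitSplit S)
  map_one' := by simp
  map_mul' A B := by
    rw [Matrix.submatrix_mul_equiv, ← Matrix.mul_kronecker_mul, one_mul]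
  map_zero' := by simp
  map_add' A B := by rw [Matrix.add_kronecker]; rfl

/-- The embedding `O ↦ I ⊗ O` of the operators on the qubits outside `S`. -/
def actOutside {N : ℕ} (S : Finset (Fin N)) :
    Matrix ({i // i ∉ S} → Fin 2) ({i // i ∉ S} → Fin 2) ℂ →+* QubitOp N where
  toFun O := ((1 : Matrix ({i // i ∈ S} → Fin 2) ({i // i ∈ S} → Fin 2) ℂ) ⊗ₖ O).submatrix
    (qubitSplit S) (qubitSplit S)
  map_one' := by simp
  map_mul' A B := by
    rw [Matrix.submatrix_mul_equiv, ← Matrix.mul_kronecker_mul, one_mul]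
  map_zero' := by simp
  map_add' A B := by rw [Matrix.kronecker_add]; rfl

theorem actInside_apply {N : ℕ} (S : Finset (Fin N))
    (O : Matrix ({i // i ∈ S} → Fin 2) ({i // i ∈ S} → Fin 2) ℂ) (x y : QubitBasis N) :
    actInside S O x y = if (fun i : {i // i ∉ S} => x i) = (fun i : {i // i ∉ S} => y i)
      then O (fun i => x i) (fun i => y i) else 0 := by
  change O (fun i => x i) (fun i => y i)
    * (1 : Matrix ({i // i ∉ S} → Fin 2) ({i // i ∉ S} → Fin 2) ℂ) (fun i => x i) (fun i => y i) = _
  rw [Matrix.one_apply, mul_ite, mul_one, mul_zero]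

theorem actOutside_apply {N : ℕ} (S : Finset (Fin N))
    (O : Matrix ({i // i ∉ S} → Fin 2) ({i // i ∉ S} → Fin 2) ℂ) (x y : QubitBasis N) :
    actOutside S O x y = if (fun i : {i // i ∈ S} => x i) = (fun i : {i // i ∈ S} => y i)
      then O (fun i => x i) (fun i => y i) else 0 := by
  change (1 : Matrix ({i // i ∈ S} → Fin 2) ({i // i ∈ S} → Fin 2) ℂ) (fun i => x i) (fun i => y i)
    * O (fun i => x i) (fun i => y i) = _
  rw [Matrix.one_apply, ite_mul, one_mul, zero_mul]

theorem actInside_smul {N : ℕ} (S : Finset (Fin N)) (c : ℂ)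
    (O : Matrix ({i // i ∈ S} → Fin 2) ({i // i ∈ S} → Fin 2) ℂ) :
    actInside S (c • O) = c • actInside S O := by
  simp only [actInside, RingHom.coe_mk, MonoidHom.coe_mk, OneHom.coe_mk, Matrix.smul_kronecker]
  rfl

theorem actOutside_smul {N : ℕ} (S : Finset (Fin N)) (c : ℂ)
    (O : Matrix ({i // i ∉ S} → Fin 2) ({i // i ∉ S} → Fin 2) ℂ) :
    actOutside S (c • O) = c • actOutside S O := by
  simp only [actOutside, RingHom.coe_mk, MonoidHom.coe_mk, OneHom.coe_mk, Matrix.kronecker_smul]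
  rfl

theorem continuous_actInside {N : ℕ} (S : Finset (Fin N)) : Continuous (actInside S) :=
  LinearMap.continuous_of_finiteDimensional
    (⟨⟨actInside S, map_add _⟩, actInside_smul S⟩ : _ →ₗ[ℂ] QubitOp N)

theorem continuous_actOutside {N : ℕ} (S : Finset (Fin N)) : Continuous (actOutside S) :=
  LinearMap.continuous_of_finiteDimensional
    (⟨⟨actOutside S, map_add _⟩, actOutside_smul S⟩ : _ →ₗ[ℂ] QubitOp N)

theorem actInside_mul_actOutside {N : ℕ} (S : Finset (Fin N))
    (A : Matrix ({i // i ∈ S} → Fin 2) ({i // i ∈ S} → Fin 2) ℂ)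
    (B : Matrix ({i // i ∉ S} → Fin 2) ({i // i ∉ S} → Fin 2) ℂ) :
    actInside S A * actOutside S B = (A ⊗ₖ B).submatrix (qubitSplit S) (qubitSplit S) := by
  change Matrix.submatrix _ _ _ * Matrix.submatrix _ _ _ = _
  rw [Matrix.submatrix_mul_equiv, ← Matrix.mul_kronecker_mul, one_mul, mul_one]

theorem commute_actInside_actOutside {N : ℕ} (S : Finset (Fin N))
    (A : Matrix ({i // i ∈ S} → Fin 2) ({i // i ∈ S} → Fin 2) ℂ)
    (B : Matrix ({i // i ∉ S} → Fin 2) ({i // i ∉ S} → Fin 2) ℂ) :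
    Commute (actInside S A) (actOutside S B) := by
  rw [Commute, SemiconjBy, actInside_mul_actOutside]
  change _ = Matrix.submatrix _ _ _ * Matrix.submatrix _ _ _
  rw [Matrix.submatrix_mul_equiv, ← Matrix.mul_kronecker_mul, one_mul, mul_one]

theorem ActsOnlyOn.exists_actInside {N : ℕ} {P : QubitOp N} {S T : Finset (Fin N)}
    (hP : ActsOnlyOn P T) (hTS : T ⊆ S) : ∃ O, P = actInside S O := by
  obtain ⟨Q, hQ⟩ := hP
  refine ⟨Matrix.of fun u v => P (fun i => if h : i ∈ S then u ⟨i, h⟩ else 0)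
    (fun i => if h : i ∈ S then v ⟨i, h⟩ else 0), ?_⟩
  ext x y
  rw [actInside_apply, Matrix.of_apply]
  split_ifs with h
  · have hS : ∀ i, i ∉ S → x i = y i := fun i hi => congrFun h ⟨i, hi⟩
    by_cases hT : ∀ i, i ∉ T → x i = y i
    · rw [(hQ x y).1 hT, (hQ _ _).1 (by
        intro i hi
        by_cases hiS : i ∈ S <;> simp [hiS, hT i hi])]
      congr 1 <;> (funext i; simp [hTS i.2])
    · push Not at hT
      obtain ⟨i, hi, hne⟩ := hT
      have hiS : i ∈ S := by_contra fun h => hne (hS i h)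
      rw [(hQ x y).2 ⟨i, hi, hne⟩, (hQ _ _).2 ⟨i, hi, by simpa [hiS] using hne⟩]
  · obtain ⟨⟨i, hi⟩, hne⟩ := Function.ne_iff.1 h
    exact (hQ x y).2 ⟨i, fun hiT => hi (hTS hiT), hne⟩

theorem ActsOnlyOn.exists_actOutside {N : ℕ} {P : QubitOp N} {S T : Finset (Fin N)}
    (hP : ActsOnlyOn P T) (hTS : Disjoint S T) : ∃ O, P = actOutside S O := by
  obtain ⟨Q, hQ⟩ := hP
  have hTS' : ∀ {i}, i ∈ T → i ∉ S := fun hi h => Finset.disjoint_left.1 hTS h hi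
  refine ⟨Matrix.of fun u v => P (fun i => if h : i ∈ S then 0 else u ⟨i, h⟩)
    (fun i => if h : i ∈ S then 0 else v ⟨i, h⟩), ?_⟩
  ext x y
  rw [actOutside_apply, Matrix.of_apply]
  split_ifs with h
  · have hS : ∀ i, i ∈ S → x i = y i := fun i hi => congrFun h ⟨i, hi⟩
    by_cases hT : ∀ i, i ∉ T → x i = y i
    · rw [(hQ x y).1 hT, (hQ _ _).1 (by
        intro i hi
        by_cases hiS : i ∈ S <;> simp [hiS, hT i hi])]
      congr 1 <;> (funext i; simp [hTS' i.2])
    · push Not at hT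
      obtain ⟨i, hi, hne⟩ := hT
      have hiS : i ∉ S := fun h => hne (hS i h)
      rw [(hQ x y).2 ⟨i, hi, hne⟩, (hQ _ _).2 ⟨i, hi, by simpa [hiS] using hne⟩]
  · obtain ⟨⟨i, hi⟩, hne⟩ := Function.ne_iff.1 h
    exact (hQ x y).2 ⟨i, fun hiT => hTS' hiT hi, hne⟩

/-- The normalized trace on `N` qubits. -/
noncomputable def normTrace {N : ℕ} : QubitOp N →ₗ[ℂ] ℂ :=
  ((2 : ℂ) ^ N)⁻¹ • Matrix.traceLinearMap (QubitBasis N) ℂ ℂ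

theorem normTrace_apply {N : ℕ} (P : QubitOp N) : normTrace P = ((2 : ℂ) ^ N)⁻¹ * P.trace := rfl

theorem trace_one_qubitOp (N : ℕ) : (1 : QubitOp N).trace = 2 ^ N := by
  simp [Matrix.trace_one]

theorem normTrace_one {N : ℕ} : normTrace (1 : QubitOp N) = 1 := by
  rw [normTrace_apply, trace_one_qubitOp]
  exact inv_mul_cancel₀ (pow_ne_zero _ two_ne_zero)

theorem trace_submatrix_equiv {m n : Type*} [Fintype m] [Fintype n] (e : m ≃ n)
    (A : Matrix n n ℂ) : (A.submatrix e e).trace = A.trace := by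
  simp only [Matrix.trace, Matrix.diag, Matrix.submatrix_apply]
  exact Equiv.sum_comp e fun i => A i i

theorem normTrace_actInside_mul_actOutside {N : ℕ} (S : Finset (Fin N))
    (A : Matrix ({i // i ∈ S} → Fin 2) ({i // i ∈ S} → Fin 2) ℂ)
    (B : Matrix ({i // i ∉ S} → Fin 2) ({i // i ∉ S} → Fin 2) ℂ) :
    normTrace (actInside S A * actOutside S B)
      = normTrace (actInside S A) * normTrace (actOutside S B) := by
  have h : ∀ A B, (actInside S A * actOutside S B).trace = A.trace * B.trace := fun A B => by
    rw [actInside_mul_actOutside, trace_submatrix_equiv, Matrix.trace_kronecker]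
  have hA := h A 1
  have hB := h 1 B
  have h1 := h 1 1
  rw [map_one, mul_one] at hA
  rw [map_one, one_mul] at hB
  rw [map_one, map_one, one_mul, trace_one_qubitOp] at h1
  simp only [normTrace_apply]
  rw [h A B, hA, hB, h1]
  have h0 : (1 : Matrix ({i // i ∈ S} → Fin 2) ({i // i ∈ S} → Fin 2) ℂ).trace ≠ 0 := by
    simp [Matrix.trace_one]
  have h0' : (1 : Matrix ({i // i ∉ S} → Fin 2) ({i // i ∉ S} → Fin 2) ℂ).trace ≠ 0 := by
    simp [Matrix.trace_one]
  field_simp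

open scoped Matrix.Norms.L2Operator in
theorem actInside_exp {N : ℕ} (S : Finset (Fin N))
    (A : Matrix ({i // i ∈ S} → Fin 2) ({i // i ∈ S} → Fin 2) ℂ) :
    actInside S (NormedSpace.exp A) = NormedSpace.exp (actInside S A) :=
  letI := NormedAlgebra.restrictScalars ℚ ℂ
    (Matrix ({i // i ∈ S} → Fin 2) ({i // i ∈ S} → Fin 2) ℂ)
  NormedSpace.map_exp (actInside S) (continuous_actInside S) A

open scoped Matrix.Norms.L2Operator in
theorem actOutside_exp {N : ℕ} (S : Finset (Fin N))
    (A : Matrix ({i // i ∉ S} → Fin 2) ({i // i ∉ S} → Fin 2) ℂ) :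
    actOutside S (NormedSpace.exp A) = NormedSpace.exp (actOutside S A) :=
  letI := NormedAlgebra.restrictScalars ℚ ℂ
    (Matrix ({i // i ∉ S} → Fin 2) ({i // i ∉ S} → Fin 2) ℂ)
  NormedSpace.map_exp (actOutside S) (continuous_actOutside S) A

/-- The partition function of two families of terms factorizes when no term of the first one
shares a qubit with a term of the second one. -/
theorem normTrace_exp_sum_add_sum {N : ℕ} {ι : Type*} (P : ι → QubitOp N) (D R : Finset ι)
    (h : ∀ d ∈ D, ∀ r ∈ R, Disjoint (qubitSupport (P d)) (qubitSupport (P r))) (x : ι → ℂ) :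
    normTrace (NormedSpace.exp (∑ d ∈ D, x d • P d + ∑ r ∈ R, x r • P r))
      = normTrace (NormedSpace.exp (∑ d ∈ D, x d • P d))
        * normTrace (NormedSpace.exp (∑ r ∈ R, x r • P r)) := by
  classical
  set S := D.biUnion fun d => qubitSupport (P d)
  have hin : ∃ A, ∑ d ∈ D, x d • P d = actInside S A := by
    have h1 : ∀ d : D, ∃ O, P d = actInside S O := fun d =>
      (actsOnlyOn_qubitSupport (P d)).exists_actInside
        (Finset.subset_biUnion_of_mem (fun d => qubitSupport (P d)) d.2)
    choose O hO using h1
    refine ⟨∑ d : D, x d • O d, ?_⟩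
    rw [map_sum, ← Finset.sum_coe_sort D]
    exact Finset.sum_congr rfl fun d _ => by rw [actInside_smul, hO d]
  have hout : ∃ B, ∑ r ∈ R, x r • P r = actOutside S B := by
    have h1 : ∀ r : R, ∃ O, P r = actOutside S O := fun r =>
      (actsOnlyOn_qubitSupport (P r)).exists_actOutside
        ((Finset.disjoint_biUnion_left _ _ _).2 fun d hd => h d hd r r.2)
    choose O hO using h1
    refine ⟨∑ r : R, x r • O r, ?_⟩
    rw [map_sum, ← Finset.sum_coe_sort R]
    exact Finset.sum_congr rfl fun r _ => by rw [actOutside_smul, hO r]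
  obtain ⟨A, hA⟩ := hin
  obtain ⟨B, hB⟩ := hout
  rw [hA, hB, Matrix.exp_add_of_commute _ _ (commute_actInside_actOutside S A B),
    ← actInside_exp, ← actOutside_exp, normTrace_actInside_mul_actOutside]

open scoped Matrix.Norms.L2Operator in
theorem Matrix.norm_apply_le_l2_opNorm {n : Type*} [Fintype n] [DecidableEq n] (A : Matrix n n ℂ)
    (i j : n) : ‖A i j‖ ≤ ‖A‖ := by
  have h1 := A.l2_opNorm_mulVec (EuclideanSpace.single j 1)
  have h2 := PiLp.norm_apply_le (WithLp.toLp 2 (A *ᵥ (EuclideanSpace.single j (1 : ℂ)).ofLp)) i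
  rw [PiLp.norm_single, norm_one, mul_one] at h1
  refine le_trans (le_of_eq ?_) (h2.trans h1)
  simp

open scoped Matrix.Norms.L2Operator in
theorem norm_normTrace_le {N : ℕ} (P : QubitOp N) : ‖normTrace P‖ ≤ ‖P‖ := by
  rw [normTrace_apply, norm_mul, norm_inv, norm_pow, Complex.norm_ofNat,
    inv_mul_le_iff₀ (by positivity)]
  calc ‖P.trace‖ ≤ ∑ _i : QubitBasis N, ‖P‖ :=
        (norm_sum_le _ _).trans (Finset.sum_le_sum fun i _ => P.norm_apply_le_l2_opNorm i i)
    _ = 2 ^ N * ‖P‖ := by simp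

end Factorization

/-! ### Zeros of the complex partition function -/

section ComplexPartitionFunction

namespace HamiltonianTerms

variable {N : ℕ} {ι : Type*}

/-- The partition function of the terms in `S`, normalized to be `1` at infinite temperature, as
a function of complex coefficients, which include the factor `-β`. -/
noncomputable def complexPartition (T : HamiltonianTerms N ι) (S : Finset ι) (x : ι → ℂ) : ℂ :=
  normTrace (NormedSpace.exp (∑ a ∈ S, x a • T.E a))

theorem complexPartition_empty (T : HamiltonianTerms N ι) (x : ι → ℂ) :
    T.complexPartition ∅ x = 1 := by
  rw [complexPartition, Finset.sum_empty, NormedSpace.exp_zero, normTrace_one]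

theorem complexPartition_erase [DecidableEq ι] (T : HamiltonianTerms N ι) {S : Finset ι} {a : ι}
    (ha : a ∈ S) (x : ι → ℂ) :
    T.complexPartition (S.erase a) x = T.complexPartition S (Function.update x a 0) := by
  unfold complexPartition
  rw [← Finset.add_sum_erase _ _ ha, Function.update_self, zero_smul, zero_add]
  congr 2
  exact Finset.sum_congr rfl fun b hb => by
    rw [Function.update_of_ne (Finset.ne_of_mem_erase hb)]

theorem complexPartition_union [DecidableEq ι] (T : HamiltonianTerms N ι) {D R : Finset ι}
    (hDR : Disjoint D R) (h : ∀ d ∈ D, ∀ r ∈ R, ¬ T.dualInteractionGraph.Adj d r) (x : ι → ℂ) :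
    T.complexPartition (D ∪ R) x = T.complexPartition D x * T.complexPartition R x := by
  unfold complexPartition
  rw [Finset.sum_union hDR]
  refine normTrace_exp_sum_add_sum T.E D R (fun d hd r hr => ?_) x
  rw [Finset.disjoint_iff_inter_eq_empty, ← Finset.not_nonempty_iff_eq_empty]
  exact fun hne => h d hd r hr ⟨fun e => Finset.disjoint_left.1 hDR hd (e ▸ hr), hne⟩

open scoped Matrix.Norms.L2Operator in
/-- The partition function has polymer weights that decay exponentially in the size of the
polymer, with a rate proportional to the coefficients. -/
theorem exists_clusterSum_eq_complexPartition [DecidableEq ι] (T : HamiltonianTerms N ι)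
    {x : ι → ℂ} {r : ℝ} (hx : ∀ a, ‖x a‖ ≤ r) :
    ∃ φ : Finset ι → ℂ, (∀ S, clusterSum φ ∅ S = T.complexPartition S x) ∧
      ∀ C, ‖φ C‖ ≤ (Real.exp r - 1) ^ C.card := by
  refine ⟨fun C => normTrace (expWordSum (fun a => x a • T.E a) C), fun S => ?_, fun C => ?_⟩
  · simp only [clusterSum, Finset.empty_union]
    rw [← map_sum, sum_powerset_expWordSum, complexPartition]
  · have hX : ∀ a, ‖x a • T.E a‖ ≤ r := fun a => by
      rw [norm_smul]
      exact (mul_le_of_le_one_right (norm_nonneg _) (T.norm_le_one a)).trans (hx a)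
    refine (norm_normTrace_le _).trans ((norm_expWordSum_le (x := fun _ => r) hX C).trans ?_)
    rw [Finset.prod_const]

open scoped Matrix.Norms.L2Operator in
theorem contDiff_complexPartition (T : HamiltonianTerms N ι) [Fintype ι] (S : Finset ι)
    {n : WithTop ℕ∞} : ContDiff ℂ n (T.complexPartition S) := by
  have h1 : ContDiff ℂ n (NormedSpace.exp : QubitOp N → QubitOp N) :=
    contDiff_iff_contDiffAt.2 fun A => (NormedSpace.exp_analytic A).contDiffAt
  have h2 : ContDiff ℂ n fun x : ι → ℂ => ∑ a ∈ S, x a • T.E a :=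
    ContDiff.sum fun a _ => (contDiff_apply ℂ ℂ a).smul contDiff_const
  exact (LinearMap.toContinuousLinearMap (normTrace (N := N))).contDiff.comp (h1.comp h2)

variable [Fintype ι] [DecidableEq ι]

/-- A polydisc without zeros of the partition function, together with a bound for the effect of
removing a single term. -/
theorem complexPartition_univ_ne_zero (T : HamiltonianTerms N ι) {x : ι → ℂ}
    (hx : ∀ a, ‖x a‖ ≤ 1 / (4 * ((T.dualDegree : ℝ) + 1) ^ 2)) :
    T.complexPartition Finset.univ x ≠ 0 ∧ ∀ a,
      ‖T.complexPartition Finset.univ x - T.complexPartition Finset.univ (Function.update x a 0)‖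
        ≤ 1 / (3 * ((T.dualDegree : ℝ) + 1)) *
          ‖T.complexPartition Finset.univ (Function.update x a 0)‖ := by
  classical
  obtain ⟨φ, hφZ, hφ⟩ := T.exists_clusterSum_eq_complexPartition hx
  set d := T.dualDegree with hd
  set r : ℝ := 1 / (4 * ((d : ℝ) + 1) ^ 2) with hr
  set η : ℝ := 1 / (3 * ((d : ℝ) + 1)) with hη
  set κ : ℝ := 1 + 1 / ((d : ℝ) + 1) with hκ
  have hd1 : (1 : ℝ) ≤ (d : ℝ) + 1 := by simp
  have hd0 : (0 : ℝ) < (d : ℝ) + 1 := by positivity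
  have hr0 : 0 ≤ r := by positivity
  have hr1 : r ≤ 1 / 4 := by
    rw [hr]
    gcongr
    nlinarith
  have hw0 : 0 ≤ Real.exp r - 1 := by linarith [Real.add_one_le_exp r]
  have hw : Real.exp r - 1 ≤ 4 / 3 * r := by
    have h1 : Real.exp r * (1 - r) ≤ 1 := by
      have := Real.one_sub_le_exp_neg r
      calc Real.exp r * (1 - r) ≤ Real.exp r * Real.exp (-r) := by gcongr
        _ = 1 := by rw [← Real.exp_add, add_neg_cancel, Real.exp_zero]
    nlinarith
  -- `κ ^ d ≤ exp (d / (d + 1))`, and `1 - u ≤ exp (-u)` for `u = d / (d + 1)`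
  have hκd : κ ^ d ≤ (d : ℝ) + 1 := by
    have h1 : κ ^ d ≤ Real.exp (d / (d + 1)) := by
      have h2 : κ ≤ Real.exp (1 / ((d : ℝ) + 1)) := by
        rw [hκ, add_comm]
        exact Real.add_one_le_exp _
      refine (pow_le_pow_left₀ (by positivity) h2 d).trans (le_of_eq ?_)
      rw [← Real.exp_nat_mul]
      congr 1
      ring
    have h3 : Real.exp (d / (d + 1)) * (1 / ((d : ℝ) + 1)) ≤ 1 := by
      have h4 : (1 : ℝ) / (d + 1) = 1 - d / (d + 1) := by field_simp; ring
      rw [h4]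
      calc Real.exp (d / (d + 1)) * (1 - d / (d + 1))
          ≤ Real.exp (d / (d + 1)) * Real.exp (-(d / (d + 1))) := by
            gcongr
            exact Real.one_sub_le_exp_neg _
        _ = 1 := by rw [← Real.exp_add, add_neg_cancel, Real.exp_zero]
    rw [mul_one_div, div_le_one hd0] at h3
    exact h1.trans h3
  have hη13 : η ≤ 1 / 3 := by
    rw [hη]
    gcongr
    linarith
  have hwη : (Real.exp r - 1) * κ ^ d ≤ η := by
    calc (Real.exp r - 1) * κ ^ d ≤ (4 / 3 * r) * ((d : ℝ) + 1) := by gcongr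
      _ = η := by rw [hr, hη]; field_simp
  have hηκ : 1 + η ≤ κ * (1 - η) := by
    have h1 : κ = 1 + 3 * η := by rw [hκ, hη]; field_simp
    have h2 : 0 ≤ η := by positivity
    rw [h1]
    nlinarith
  have hstep := fun b B (hb : b ∉ B) => norm_clusterSum_insert_sub_le (φ := φ)
    (nbr := fun a => T.dualInteractionGraph.neighborFinset a) (d := d) (κ := κ) (η := η)
    (fun D R hDR h => by
      rw [hφZ, hφZ, hφZ]
      exact T.complexPartition_union hDR (fun d hd r hr => by simpa using h d hd r hr) x)
    hφ (fun a => by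
      rw [SimpleGraph.card_neighborFinset_eq_degree, hd, dualDegree]
      exact SimpleGraph.degree_le_maxDegree _ a) hw0 (by rw [hκ]; simp; positivity) hwη hηκ hb
  have hφ0 : φ ∅ ≠ 0 := by
    rw [← clusterSum_empty_right φ ∅, hφZ, complexPartition_empty]
    exact one_ne_zero
  refine ⟨?_, fun a => ?_⟩
  · rw [← hφZ]
    exact clusterSum_ne_zero (by linarith) hφ0 hstep _
  · have h := hstep a (Finset.univ.erase a) (Finset.notMem_erase _ _)
    rwa [Finset.insert_erase (Finset.mem_univ a), hφZ, hφZ,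
      T.complexPartition_erase (Finset.mem_univ a)] at h

/-- The logarithmic derivatives of the partition function are bounded on a polydisc, by the Cauchy
estimate in one coefficient. -/
theorem norm_fderiv_complexPartition_le (T : HamiltonianTerms N ι) {x : ι → ℂ}
    (hx : ∀ a, ‖x a‖ ≤ 1 / (8 * ((T.dualDegree : ℝ) + 1) ^ 2)) (a : ι) :
    ‖fderiv ℂ (T.complexPartition Finset.univ) x (Pi.single a 1)‖
      ≤ 4 * ((T.dualDegree : ℝ) + 1) * ‖T.complexPartition Finset.univ x‖ := by
  set Z := T.complexPartition Finset.univ with hZ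
  set d : ℝ := (T.dualDegree : ℝ) with hd
  have hd0 : (0 : ℝ) ≤ d := by positivity
  set ρ : ℝ := 1 / (8 * (d + 1) ^ 2) with hρ
  have hρ0 : 0 < ρ := by positivity
  have hρ2 : 1 / (4 * (d + 1) ^ 2) = ρ + ρ := by rw [hρ]; field_simp; norm_num
  have hdiff : Differentiable ℂ Z := (T.contDiff_complexPartition _).differentiable one_ne_zero
  -- the value without the term `a`, which does not depend on the coefficient that is varied
  set z₀ := Z (Function.update x a 0) with hz₀
  set η : ℝ := 1 / (3 * (d + 1)) with hη
  have hbound : ∀ z : ℂ, ‖z‖ ≤ ρ → ‖Z (x + z • Pi.single a 1) - z₀‖ ≤ η * ‖z₀‖ := by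
    intro z hz
    have h := (T.complexPartition_univ_ne_zero (x := x + z • Pi.single a 1) (fun b => by
      rw [← hd, hρ2]
      refine (norm_add_le _ _).trans (add_le_add (hx b) ?_)
      by_cases hb : b = a
      · subst hb
        simpa using hz
      · simp [hb, hρ0.le])).2 a
    have e : Function.update (x + z • Pi.single a 1) a 0 = Function.update x a 0 := by
      ext b
      by_cases hb : b = a
      · subst hb
        simp
      · simp [hb]
    rwa [e] at h
  have hder : HasDerivAt (fun z : ℂ => Z (x + z • Pi.single a 1) - z₀)
      (fderiv ℂ Z x (Pi.single a 1)) 0 := by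
    have h1 : HasDerivAt (fun z : ℂ => x + z • (Pi.single a 1 : ι → ℂ)) (Pi.single a 1) 0 := by
      simpa using ((hasDerivAt_id (0 : ℂ)).smul_const (Pi.single a 1 : ι → ℂ)).const_add x
    have h2 : HasFDerivAt Z (fderiv ℂ Z x) (x + (0 : ℂ) • Pi.single a 1) := by
      rw [zero_smul, add_zero]
      exact (hdiff x).hasFDerivAt
    exact (h2.comp_hasDerivAt 0 h1).sub_const z₀
  have hcauchy : ‖fderiv ℂ Z x (Pi.single a 1)‖ ≤ η * ‖z₀‖ / ρ := by
    rw [← hder.deriv]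
    refine Complex.norm_deriv_le_of_forall_mem_sphere_norm_le hρ0 ?_ fun z hz =>
      hbound z (by simpa using (mem_sphere_zero_iff_norm.1 hz).le)
    refine Differentiable.diffContOnCl ?_
    exact (hdiff.comp ((differentiable_id.smul_const _).const_add x)).sub_const z₀
  have hz₀Z : 2 / 3 * ‖z₀‖ ≤ ‖Z x‖ := by
    have h1 := hbound 0 (by simpa using hρ0.le)
    rw [zero_smul, add_zero, norm_sub_rev] at h1
    have h2 := norm_sub_norm_le z₀ (Z x)
    have h3 : η ≤ 1 / 3 := by
      rw [hη]
      gcongr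
      linarith
    nlinarith [norm_nonneg z₀]
  refine hcauchy.trans ?_
  have e : η * ‖z₀‖ / ρ = 4 * (d + 1) * (2 / 3 * ‖z₀‖) := by
    rw [hη, hρ]
    field_simp
    ring
  rw [e]
  gcongr

end HamiltonianTerms

end ComplexPartitionFunction

/-! ### Cauchy estimates on a polydisc -/

section Cauchy

/-- If `G` is holomorphic and bounded by `K` on the polydisc of radius `ρ`, then its derivative
changes by `O(β)` between the centre and a point at distance `β`, when it is applied to vectors `θ`
in the unit polydisc. This follows from the Schwarz lemma along the ray to `x` and the Cauchy
estimate in the direction `θ`. -/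
theorem norm_fderiv_sub_fderiv_zero_le {ι : Type*} [Fintype ι] {G : (ι → ℂ) → ℂ} {K ρ β : ℝ}
    (hβ : 0 < β) (hβρ : 2 * β < ρ)
    (hG : ∀ y : ι → ℂ, ‖y‖ ≤ ρ → DifferentiableAt ℂ G y)
    (hK : ∀ y : ι → ℂ, ‖y‖ ≤ ρ → ‖G y‖ ≤ K) {x θ : ι → ℂ} (hx : ‖x‖ ≤ β) (hθ : ‖θ‖ ≤ 1) :
    ‖fderiv ℂ G x θ - fderiv ℂ G 0 θ‖ ≤ 8 * K * β / ρ ^ 2 := by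
  have hρ : 0 < ρ := by linarith
  have hK0 : 0 ≤ K := (norm_nonneg _).trans (hK 0 (by simpa using hρ.le))
  have hmem : ∀ s t : ℂ, ‖s‖ ≤ ρ / (2 * β) → ‖t‖ ≤ ρ / 2 → ‖s • x + t • θ‖ ≤ ρ := by
    intro s t hs ht
    calc ‖s • x + t • θ‖ ≤ ‖s‖ * ‖x‖ + ‖t‖ * ‖θ‖ := by
          simpa only [norm_smul] using norm_add_le (s • x) (t • θ)
      _ ≤ ρ / (2 * β) * β + ρ / 2 * 1 := by gcongr
      _ = ρ := by field_simp; norm_num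
  have h1ρ : 1 < ρ / (2 * β) := by rwa [one_lt_div (by linarith)]
  have hd : ∀ s t : ℂ, ‖s‖ ≤ ρ / (2 * β) → ‖t‖ ≤ ρ / 2 →
      HasDerivAt (fun t : ℂ => G (s • x + t • θ)) (fderiv ℂ G (s • x + t • θ) θ) t := by
    intro s t hs ht
    have h1 : HasDerivAt (fun t : ℂ => s • x + t • θ) θ t := by
      simpa using ((hasDerivAt_id t).smul_const θ).const_add (s • x)
    exact (hG _ (hmem s t hs ht)).hasFDerivAt.comp_hasDerivAt t h1
  have hschwarz : ∀ t : ℂ, ‖t‖ ≤ ρ / 2 →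
      ‖G ((1 : ℂ) • x + t • θ) - G ((0 : ℂ) • x + t • θ)‖ ≤ 4 * K * β / ρ := by
    intro t ht
    have h := Complex.dist_le_div_mul_dist_of_mapsTo_ball
      (f := fun s : ℂ => G (s • x + t • θ)) (c := 0) (z := 1) (R₁ := ρ / (2 * β)) (R₂ := 2 * K)
      (fun s hs => by
        have hs' := (mem_ball_zero_iff.1 hs).le
        have h1 : DifferentiableAt ℂ (fun s : ℂ => s • x + t • θ) s :=
          (differentiableAt_id.smul_const x).add_const _
        exact ((hG _ (hmem s t hs' ht)).comp s h1).differentiableWithinAt)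
      (fun s hs => by
        rw [mem_closedBall_iff_norm]
        refine (norm_sub_le _ _).trans ?_
        have h1 := hK _ (hmem s t (mem_ball_zero_iff.1 hs).le ht)
        have h2 := hK _ (hmem 0 t (by rw [norm_zero]; linarith) ht)
        linarith)
      (by simpa using h1ρ)
    rw [dist_eq_norm, dist_eq_norm, sub_zero, norm_one, mul_one] at h
    refine h.trans (le_of_eq ?_)
    field_simp
    ring
  have hder : HasDerivAt (fun t : ℂ => G ((1 : ℂ) • x + t • θ) - G ((0 : ℂ) • x + t • θ))
      (fderiv ℂ G x θ - fderiv ℂ G 0 θ) 0 := by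
    have h0 : ‖(0 : ℂ)‖ ≤ ρ / 2 := by rw [norm_zero]; linarith
    have h := (hd 1 0 (by rw [norm_one]; linarith) h0).fun_sub
      (hd 0 0 (by rw [norm_zero]; linarith) h0)
    simpa using h
  rw [← hder.deriv]
  have e : 8 * K * β / ρ ^ 2 = 4 * K * β / ρ / (ρ / 2) := by field_simp; ring
  rw [e]
  refine Complex.norm_deriv_le_of_forall_mem_sphere_norm_le (by linarith) ?_ fun t ht =>
    hschwarz t (mem_sphere_zero_iff_norm.1 ht).le
  refine DifferentiableOn.diffContOnCl_ball (U := Metric.closedBall 0 (ρ / 2)) ?_ subset_rfl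
  intro t ht
  have ht' : ‖t‖ ≤ ρ / 2 := mem_closedBall_zero_iff.1 ht
  exact ((hd 1 t (by rw [norm_one]; linarith) ht').differentiableAt.sub
    (hd 0 t (by rw [norm_zero]; linarith) ht').differentiableAt).differentiableWithinAt

end Cauchy

/-! ### Logarithmic derivatives at high temperature -/

section HighTemperatureLimit

theorem hasDerivAt_fderiv_ray {E : Type*} [NormedAddCommGroup E] [NormedSpace ℂ E] {f : E → ℂ}
    (hf : ContDiff ℂ 2 f) (v w : E) :
    HasDerivAt (fun z : ℂ => fderiv ℂ f (z • v) w) (fderiv ℂ (fderiv ℂ f) 0 v w) 0 := by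
  have h1 : HasDerivAt (fun z : ℂ => z • v) v 0 := by
    simpa using (hasDerivAt_id (0 : ℂ)).smul_const v
  have h2 : HasFDerivAt (fderiv ℂ f) (fderiv ℂ (fderiv ℂ f) 0) ((0 : ℂ) • v) := by
    rw [zero_smul]
    exact ((hf.fderiv_right (m := 1) (by norm_num)).differentiable one_ne_zero 0).hasFDerivAt
  have h3 : HasDerivAt (fun z : ℂ => fderiv ℂ f (z • v)) (fderiv ℂ (fderiv ℂ f) 0 v) 0 :=
    h2.comp_hasDerivAt 0 h1
  simpa using h3.clm_apply (hasDerivAt_const (0 : ℂ) w)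

namespace HamiltonianTerms

variable {N : ℕ} {ι : Type*} [Fintype ι]

open scoped Matrix.Norms.L2Operator in
theorem fderiv_complexPartition_ray (T : HamiltonianTerms N ι) (v : ι → ℂ) (z : ℂ) :
    fderiv ℂ (T.complexPartition Finset.univ) (z • v) v
      = normTrace (NormedSpace.exp (z • ∑ a, v a • T.E a) * ∑ a, v a • T.E a) := by
  have h1 : HasDerivAt (fun z : ℂ => z • v) v z := by
    simpa using (hasDerivAt_id z).smul_const v
  have h2 : HasFDerivAt (T.complexPartition Finset.univ)
      (fderiv ℂ (T.complexPartition Finset.univ) (z • v)) (z • v) :=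
    ((T.contDiff_complexPartition (n := 1) _).differentiable one_ne_zero _).hasFDerivAt
  have h3 := h2.comp_hasDerivAt z h1
  have h4 := (LinearMap.toContinuousLinearMap (normTrace (N := N))).hasFDerivAt.comp_hasDerivAt z
    (hasDerivAt_exp_smul_const (∑ a, v a • T.E a) z)
  refine h3.unique (h4.congr_of_eventuallyEq (Filter.Eventually.of_forall fun z => ?_))
  simp [complexPartition, Finset.smul_sum, smul_smul]

theorem normTrace_mul_self (T : HamiltonianTerms N ι) (hT : T.TracelessOrthonormal)
    (v : ι → ℂ) :
    normTrace ((∑ a, v a • T.E a) * ∑ a, v a • T.E a) = ∑ a, v a * v a := by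
  classical
  have h : ∀ a b, normTrace (T.E a * T.E b) = if a = b then 1 else 0 := fun a b => by
    rw [normTrace_apply]
    split_ifs with hab
    · subst hab
      have h1 := hT.2.1 a
      rw [(T.isHermitian a).eq] at h1
      rw [h1]
      exact inv_mul_cancel₀ (pow_ne_zero _ two_ne_zero)
    · have h1 := hT.2.2 a b hab
      rw [(T.isHermitian a).eq] at h1
      rw [h1, mul_zero]
  simp [Finset.sum_mul, Finset.mul_sum, h]

theorem fderiv_complexPartition_zero (T : HamiltonianTerms N ι) (hT : T.TracelessOrthonormal)
    (v : ι → ℂ) : fderiv ℂ (T.complexPartition Finset.univ) 0 v = 0 := by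
  have h := T.fderiv_complexPartition_ray v 0
  rw [zero_smul, zero_smul, NormedSpace.exp_zero, one_mul] at h
  rw [h, map_sum]
  refine Finset.sum_eq_zero fun a _ => ?_
  rw [map_smul, normTrace_apply, hT.1 a, mul_zero, smul_zero]

open scoped Matrix.Norms.L2Operator in
theorem fderiv_fderiv_complexPartition_zero (T : HamiltonianTerms N ι)
    (hT : T.TracelessOrthonormal) (v w : ι → ℂ) :
    fderiv ℂ (fderiv ℂ (T.complexPartition Finset.univ)) 0 v w = ∑ a, v a * w a := by
  set Z := T.complexPartition Finset.univ with hZ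
  have hC : ContDiff ℂ 2 Z := T.contDiff_complexPartition _
  have hdiag : ∀ v : ι → ℂ, fderiv ℂ (fderiv ℂ Z) 0 v v = ∑ a, v a * v a := by
    intro v
    have h3 := hasDerivAt_fderiv_ray hC v v
    have h4 : HasDerivAt (fun z : ℂ => fderiv ℂ Z (z • v) v)
        (normTrace (NormedSpace.exp ((0 : ℂ) • ∑ a, v a • T.E a) * (∑ a, v a • T.E a)
          * ∑ a, v a • T.E a)) 0 := by
      simp only [hZ, T.fderiv_complexPartition_ray]
      exact (LinearMap.toContinuousLinearMap (normTrace (N := N))).hasFDerivAt.comp_hasDerivAt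
        (0 : ℂ) ((hasDerivAt_exp_smul_const (∑ a, v a • T.E a) (0 : ℂ)).mul_const
          (∑ a, v a • T.E a))
    rw [h3.unique h4, zero_smul, NormedSpace.exp_zero, one_mul, T.normTrace_mul_self hT]
  have hsymm : fderiv ℂ (fderiv ℂ Z) 0 v w = fderiv ℂ (fderiv ℂ Z) 0 w v :=
    (hC.contDiffAt.isSymmSndFDerivAt (by simp)).eq v w
  -- polarization
  have h := hdiag (v + w)
  simp only [map_add, _root_.add_apply, Pi.add_apply, hdiag, ← hsymm] at h
  have e : ∑ a, (v a + w a) * (v a + w a)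
      = ∑ a, v a * v a + ∑ a, w a * w a + 2 * ∑ a, v a * w a := by
    rw [Finset.mul_sum, ← Finset.sum_add_distrib, ← Finset.sum_add_distrib]
    exact Finset.sum_congr rfl fun a _ => by ring
  rw [e] at h
  linear_combination h / 2

variable [DecidableEq ι]

/-- The logarithmic derivative of the partition function in the coefficient with index `b`. -/
noncomputable def logDerivPartition (T : HamiltonianTerms N ι) (b : ι) (x : ι → ℂ) : ℂ :=
  fderiv ℂ (T.complexPartition Finset.univ) x (Pi.single b 1) / T.complexPartition Finset.univ x

theorem differentiableAt_logDerivPartition (T : HamiltonianTerms N ι) (b : ι) {x : ι → ℂ}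
    (hx : T.complexPartition Finset.univ x ≠ 0) :
    DifferentiableAt ℂ (T.logDerivPartition b) x := by
  have hC : ContDiff ℂ 2 (T.complexPartition Finset.univ) := T.contDiff_complexPartition _
  have h1 := ((hC.fderiv_right (m := 1) (by norm_num)).differentiable one_ne_zero).clm_apply
    (differentiable_const (Pi.single b (1 : ℂ) : ι → ℂ))
  unfold logDerivPartition
  simp only [div_eq_mul_inv]
  exact (h1 x).fun_mul ((hC.differentiable two_ne_zero x).fun_inv hx)

theorem fderiv_logDerivPartition_zero (T : HamiltonianTerms N ι) (hT : T.TracelessOrthonormal)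
    (b : ι) (θ : ι → ℂ) : fderiv ℂ (T.logDerivPartition b) 0 θ = θ b := by
  set Z := T.complexPartition Finset.univ with hZ
  have hC : ContDiff ℂ 2 Z := T.contDiff_complexPartition _
  have hZ0 : Z 0 = 1 := by simp [hZ, complexPartition, normTrace_one]
  have hne : Z ((0 : ℂ) • θ) ≠ 0 := by rw [zero_smul, hZ0]; exact one_ne_zero
  have h1 : HasDerivAt (fun z : ℂ => z • θ) θ 0 := by
    simpa using (hasDerivAt_id (0 : ℂ)).smul_const θ
  have hdiff := T.differentiableAt_logDerivPartition b hne
  have h2 : HasDerivAt (fun z : ℂ => T.logDerivPartition b (z • θ))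
      (fderiv ℂ (T.logDerivPartition b) ((0 : ℂ) • θ) θ) 0 := by
    have h := hdiff.hasFDerivAt
    exact h.comp_hasDerivAt (0 : ℂ) h1
  have h3 := hasDerivAt_fderiv_ray hC θ (Pi.single b 1)
  have h4 : HasDerivAt (fun z : ℂ => Z (z • θ)) (fderiv ℂ Z ((0 : ℂ) • θ) θ) 0 :=
    (hC.differentiable two_ne_zero _).hasFDerivAt.comp_hasDerivAt (0 : ℂ) h1
  have h5 := h2.unique (h3.fun_div h4 hne)
  rw [zero_smul] at h5
  rw [h5, ← hZ, hZ0, hZ, T.fderiv_complexPartition_zero hT, T.fderiv_fderiv_complexPartition_zero hT]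
  simp [Pi.single_apply]

/-- On the polydisc that corresponds to the coefficient cube, the derivatives of the logarithmic
derivatives are those at infinite temperature, up to `1 / 2` in row sum. -/
theorem sum_abs_re_fderiv_logDerivPartition_le (T : HamiltonianTerms N ι)
    (hT : T.TracelessOrthonormal) {β : ℝ} (hβ : 0 < β)
    (hβd : 4096 * ((T.dualDegree : ℝ) + 1) ^ 5 * β ≤ 1) {x : ι → ℂ} (hx : ∀ a, ‖x a‖ ≤ β)
    (b : ι) :
    ∑ a, |(fderiv ℂ (T.logDerivPartition b) x (Pi.single a 1)).re - if a = b then 1 else 0|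
      ≤ 1 / 2 := by
  set d : ℝ := (T.dualDegree : ℝ) with hd
  have hd1 : 1 ≤ d + 1 := by rw [hd]; simp
  set ρ : ℝ := 1 / (8 * (d + 1) ^ 2) with hρ
  have hρ0 : 0 < ρ := by positivity
  -- the point `x` lies well inside the polydisc, so that the Schwarz lemma applies
  have hsmall : 2 * β < ρ := by
    rw [hρ, lt_div_iff₀ (by positivity)]
    have h1 : (d + 1) ^ 2 ≤ (d + 1) ^ 5 := pow_le_pow_right₀ hd1 (by norm_num)
    have h2 : 0 < (d + 1) ^ 2 := by positivity
    nlinarith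
  have hpoly : ∀ y : ι → ℂ, ‖y‖ ≤ ρ → T.complexPartition Finset.univ y ≠ 0 := fun y hy =>
    (T.complexPartition_univ_ne_zero fun a => ((norm_le_pi_norm y a).trans hy).trans (by
      rw [← hd, hρ]
      gcongr
      norm_num)).1
  -- in the direction of the signs `θ`, the derivative adds up the absolute values of the errors
  set A : ι → ℝ := fun a =>
    (fderiv ℂ (T.logDerivPartition b) x (Pi.single a 1)).re - if a = b then 1 else 0 with hA
  set θ : ι → ℂ := fun a => ((SignType.sign (A a) : ℝ) : ℂ) with hθ
  have h := norm_fderiv_sub_fderiv_zero_le (G := T.logDerivPartition b) (K := 4 * (d + 1))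
    (θ := θ) hβ hsmall (fun y hy => T.differentiableAt_logDerivPartition b (hpoly y hy))
    (fun y hy => by
      rw [logDerivPartition, norm_div, div_le_iff₀ (norm_pos_iff.2 (hpoly y hy))]
      exact T.norm_fderiv_complexPartition_le (fun a => (norm_le_pi_norm y a).trans hy) b)
    ((pi_norm_le_iff_of_nonneg hβ.le).2 hx) ((pi_norm_le_iff_of_nonneg zero_le_one).2 fun a => by
      rw [hθ, Complex.norm_real]
      rcases lt_trichotomy (A a) 0 with h | h | h <;> simp [h])
  have hsum : (fderiv ℂ (T.logDerivPartition b) x θ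
      - fderiv ℂ (T.logDerivPartition b) 0 θ).re = ∑ a, |A a| := by
    have e : θ = ∑ a, θ a • (Pi.single a 1 : ι → ℂ) := by
      ext c
      simp [Finset.sum_apply, Pi.single_apply]
    rw [T.fderiv_logDerivPartition_zero hT]
    nth_rewrite 1 [e]
    rw [map_sum, Complex.sub_re, Complex.re_sum]
    have e2 : (θ b).re = ∑ a, (SignType.sign (A a) : ℝ) * if a = b then 1 else 0 := by
      simp [hθ]
    rw [e2, ← Finset.sum_sub_distrib]
    refine Finset.sum_congr rfl fun a _ => ?_
    rw [map_smul, smul_eq_mul, hθ, Complex.re_ofReal_mul, ← mul_sub]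
    exact sign_mul_self (A a)
  rw [← hsum]
  refine (Complex.re_le_norm _).trans (h.trans ?_)
  have e : 8 * (4 * (d + 1)) * β / ρ ^ 2 = 1 / 2 * (4096 * (d + 1) ^ 5 * β) := by
    rw [hρ]
    field_simp
    norm_num
  rw [e]
  linarith

end HamiltonianTerms

end HighTemperatureLimit

/-! ### Hessians and strong convexity -/

section Hessian

variable {ι : Type*} [Fintype ι]

/-- The Schur test for a symmetric matrix. -/
theorem abs_sum_sum_mul_mul_le {A : ι → ι → ℝ} {c : ℝ} (hsymm : ∀ a b, A a b = A b a)
    (hA : ∀ b, ∑ a, |A a b| ≤ c) (v : ι → ℝ) :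
    |∑ a, ∑ b, v a * A a b * v b| ≤ c * ∑ a, v a ^ 2 := by
  have h1 : ∀ a b, |v a * A a b * v b| ≤ |A a b| * v a ^ 2 / 2 + |A a b| * v b ^ 2 / 2 := by
    intro a b
    rw [abs_mul, abs_mul, ← sq_abs (v a), ← sq_abs (v b)]
    nlinarith [mul_nonneg (abs_nonneg (A a b)) (sq_nonneg (|v a| - |v b|))]
  have h2 : ∑ a, ∑ b, |A a b| * v b ^ 2 / 2 ≤ c / 2 * ∑ b, v b ^ 2 := by
    rw [Finset.sum_comm, Finset.mul_sum]
    refine Finset.sum_le_sum fun b _ => ?_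
    rw [← Finset.sum_div, ← Finset.sum_mul]
    nlinarith [mul_le_mul_of_nonneg_right (hA b) (sq_nonneg (v b))]
  have h3 : ∑ a, ∑ b, |A a b| * v a ^ 2 / 2 = ∑ a, ∑ b, |A a b| * v b ^ 2 / 2 := by
    rw [Finset.sum_comm]
    exact Finset.sum_congr rfl fun a _ => Finset.sum_congr rfl fun b _ => by rw [hsymm]
  calc |∑ a, ∑ b, v a * A a b * v b|
      ≤ ∑ a, ∑ b, (|A a b| * v a ^ 2 / 2 + |A a b| * v b ^ 2 / 2) := by
        refine (Finset.abs_sum_le_sum_abs _ _).trans (Finset.sum_le_sum fun a _ => ?_)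
        exact (Finset.abs_sum_le_sum_abs _ _).trans (Finset.sum_le_sum fun b _ => h1 a b)
    _ = ∑ a, ∑ b, |A a b| * v a ^ 2 / 2 + ∑ a, ∑ b, |A a b| * v b ^ 2 / 2 := by
        simp only [Finset.sum_add_distrib]
    _ ≤ c * ∑ a, v a ^ 2 := by linarith

theorem hessianMatrix_apply [DecidableEq ι] {f : EuclideanSpace ℝ ι → ℝ} (hf : ContDiff ℝ 2 f)
    (x : EuclideanSpace ℝ ι) (a b : ι) :
    hessianMatrix f x a b = fderiv ℝ (fderiv ℝ f) x (EuclideanSpace.single a 1)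
      (EuclideanSpace.single b 1) := by
  have h1 : Differentiable ℝ f := hf.differentiable two_ne_zero
  have h2 : Differentiable ℝ (fderiv ℝ f) :=
    (hf.fderiv_right (m := 1) (by norm_num)).differentiable one_ne_zero
  have h3 : (fun y => lineDeriv ℝ f y (EuclideanSpace.single b 1))
      = fun y => fderiv ℝ f y (EuclideanSpace.single b 1) :=
    funext fun y => (h1 y).lineDeriv_eq_fderiv
  have h4 : HasFDerivAt (fun y => fderiv ℝ f y (EuclideanSpace.single b 1))
      ((fderiv ℝ (fderiv ℝ f) x).flip (EuclideanSpace.single b 1)) x := by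
    simpa using (h2 x).hasFDerivAt.clm_apply
      (hasFDerivAt_const (EuclideanSpace.single b (1 : ℝ)) x)
  rw [hessianMatrix, Matrix.of_apply, h3, (h4.hasLineDerivAt _).lineDeriv]
  rfl

theorem hessianMatrix_symm [DecidableEq ι] {f : EuclideanSpace ℝ ι → ℝ} (hf : ContDiff ℝ 2 f)
    (x : EuclideanSpace ℝ ι) (a b : ι) : hessianMatrix f x a b = hessianMatrix f x b a := by
  rw [hessianMatrix_apply hf, hessianMatrix_apply hf]
  exact (hf.contDiffAt.isSymmSndFDerivAt (by simp)).eq _ _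

theorem fderiv_fderiv_eq_sum_hessianMatrix [DecidableEq ι] {f : EuclideanSpace ℝ ι → ℝ}
    (hf : ContDiff ℝ 2 f) (x v : EuclideanSpace ℝ ι) :
    fderiv ℝ (fderiv ℝ f) x v v = ∑ a, ∑ b, v a * hessianMatrix f x a b * v b := by
  have e : v = ∑ a, v a • EuclideanSpace.single a (1 : ℝ) := by
    ext c
    simp [Pi.single_apply]
  nth_rewrite 1 2 [e]
  simp only [hessianMatrix_apply hf, map_sum, map_smul, _root_.sum_apply,
    _root_.smul_apply, smul_eq_mul, Finset.mul_sum]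
  rw [Finset.sum_comm]
  exact Finset.sum_congr rfl fun a _ => Finset.sum_congr rfl fun b _ => by ring

theorem strongConvexOn_of_fderiv_fderiv {E : Type*} [NormedAddCommGroup E] [InnerProductSpace ℝ E]
    {f : E → ℝ} (hf : ContDiff ℝ 2 f) {s : Set E} (hs : Convex ℝ s) {m : ℝ}
    (h : ∀ x ∈ s, ∀ v, m * ‖v‖ ^ 2 ≤ fderiv ℝ (fderiv ℝ f) x v v) : StrongConvexOn s m f := by
  rw [strongConvexOn_iff_convex]
  refine ⟨hs, fun x hx y hy a b ha hb hab => ?_⟩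
  set u := y - x with hu
  have h1 : Differentiable ℝ f := hf.differentiable two_ne_zero
  have h2 : Differentiable ℝ (fderiv ℝ f) :=
    (hf.fderiv_right (m := 1) (by norm_num)).differentiable one_ne_zero
  have hline : ∀ t : ℝ, HasDerivAt (fun t : ℝ => x + t • u) u t := fun t => by
    simpa using ((hasDerivAt_id t).smul_const u).const_add x
  have hd1 : ∀ t : ℝ, HasDerivAt (fun t : ℝ => f (x + t • u) - m / 2 * ‖x + t • u‖ ^ 2)
      (fderiv ℝ f (x + t • u) u - m * inner ℝ (x + t • u) u) t := fun t => by
    refine ((h1 _).hasFDerivAt.comp_hasDerivAt t (hline t)).sub ?_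
    exact ((hline t).norm_sq.const_mul (m / 2)).congr_deriv (by ring)
  have hd2 : ∀ t : ℝ, HasDerivAt (fun t : ℝ => fderiv ℝ f (x + t • u) u
      - m * inner ℝ (x + t • u) u)
      (fderiv ℝ (fderiv ℝ f) (x + t • u) u u - m * ‖u‖ ^ 2) t := fun t => by
    refine HasDerivAt.sub ?_ ?_
    · simpa using ((h2 _).hasFDerivAt.comp_hasDerivAt t (hline t)).clm_apply
        (hasDerivAt_const t u)
    · have h3 := ((hline t).inner ℝ (hasDerivAt_const t u)).const_mul m
      simpa [real_inner_self_eq_norm_sq] using h3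
  have hconv : ConvexOn ℝ (Set.Icc (0 : ℝ) 1)
      fun t : ℝ => f (x + t • u) - m / 2 * ‖x + t • u‖ ^ 2 := by
    refine convexOn_of_hasDerivWithinAt2_nonneg (convex_Icc 0 1)
      (fun t _ => (hd1 t).continuousAt.continuousWithinAt)
      (fun t _ => (hd1 t).hasDerivWithinAt) (fun t _ => (hd2 t).hasDerivWithinAt) fun t ht => ?_
    have hmem : x + t • u ∈ s := hs.add_smul_sub_mem hx hy (interior_subset ht)
    exact sub_nonneg.2 (h _ hmem u)
  have h3 := hconv.2 (Set.left_mem_Icc.2 zero_le_one) (Set.right_mem_Icc.2 zero_le_one) ha hb hab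
  have e : a • x + b • y = x + b • u := by
    rw [hu, eq_sub_of_add_eq hab]
    module
  rw [e]
  simpa [hu] using h3

theorem convex_coefficientCube (ι : Type*) : Convex ℝ (coefficientCube ι) := by
  intro x hx y hy a b ha hb hab i
  exact convex_Icc (-1 : ℝ) 1 (hx i) (hy i) ha hb hab

/-- A function on the cube whose second derivative is at most `c` is not strongly convex with a
constant above `c`: on the segment from `-e_a` to `e_a` the difference of the two quadratic
bounds would be both convex and strictly concave. -/
theorem StrongConvexOn.le_of_fderiv_fderiv_le [Nonempty ι] {f : EuclideanSpace ℝ ι → ℝ}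
    (hf : ContDiff ℝ 2 f) {c m : ℝ}
    (h : ∀ x ∈ coefficientCube ι, ∀ v, fderiv ℝ (fderiv ℝ f) x v v ≤ c * ‖v‖ ^ 2)
    (hm : StrongConvexOn (coefficientCube ι) m f) : m ≤ c := by
  classical
  have hneg : StrongConvexOn (coefficientCube ι) (-c) (fun x => -f x) := by
    refine strongConvexOn_of_fderiv_fderiv hf.neg (convex_coefficientCube ι) fun x hx v => ?_
    have e : fderiv ℝ (fun x => -f x) = fun x => -fderiv ℝ f x := funext fun x => fderiv_fun_neg
    rw [e, fderiv_fun_neg]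
    simpa using h x hx v
  obtain ⟨a⟩ := ‹Nonempty ι›
  set e : EuclideanSpace ℝ ι := EuclideanSpace.single a 1 with he
  have hcube : ∀ t : ℝ, t ∈ Set.Icc (-1 : ℝ) 1 → t • e ∈ coefficientCube ι := by
    intro t ht i
    by_cases hi : i = a
    · subst hi
      simpa [he] using ht
    · simp [he, hi]
  have h1 := hcube 1 (by norm_num)
  have h2 := hcube (-1) (by norm_num)
  have hn : ‖(1 : ℝ) • e - (-1 : ℝ) • e‖ = 2 := by
    rw [← sub_smul, norm_smul, he, PiLp.norm_single]
    norm_num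
  have hhalf : (0 : ℝ) ≤ 1 / 2 := by norm_num
  have h3 := hm.2 h1 h2 hhalf hhalf (add_halves 1)
  have h4 := hneg.2 h1 h2 hhalf hhalf (add_halves 1)
  simp only [hn, smul_eq_mul] at h3 h4
  linarith

end Hessian

/-! ### The Hessian of the log-partition function -/

section LogPartition

namespace HamiltonianTerms

variable {N : ℕ} {ι : Type*} [Fintype ι]

/-- The real coefficients `x`, scaled by `-β`, as complex coefficients. -/
noncomputable def scaledCoeff (ι : Type*) [Fintype ι] (β : ℝ) :
    EuclideanSpace ℝ ι →L[ℝ] (ι → ℂ) :=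
  ContinuousLinearMap.pi fun a =>
    (-β) • Complex.ofRealCLM.comp (EuclideanSpace.proj (𝕜 := ℝ) a)

theorem scaledCoeff_apply (β : ℝ) (x : EuclideanSpace ℝ ι) (a : ι) :
    scaledCoeff ι β x a = -β * x a := by
  simp [scaledCoeff]

theorem scaledCoeff_single [DecidableEq ι] (β : ℝ) (a : ι) :
    scaledCoeff ι β (EuclideanSpace.single a 1) = (-β : ℂ) • Pi.single a 1 := by
  ext b
  rw [scaledCoeff_apply]
  by_cases hb : b = a
  · subst hb
    simp
  · simp [hb]

theorem complexPartition_scaledCoeff (T : HamiltonianTerms N ι) (β : ℝ)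
    (x : EuclideanSpace ℝ ι) :
    T.complexPartition Finset.univ (scaledCoeff ι β x)
      = ((((2 : ℝ) ^ N)⁻¹ * T.partitionFunction β x : ℝ) : ℂ) := by
  rw [complexPartition, normTrace_apply, Complex.ofReal_mul, ofReal_partitionFunction, hamiltonian,
    Finset.smul_sum]
  simp only [scaledCoeff_apply, smul_smul]
  push_cast
  rfl

theorem logPartition_eq (T : HamiltonianTerms N ι) (β : ℝ) :
    T.logPartition β = fun x =>
      Real.log (2 ^ N) + Real.log (T.complexPartition Finset.univ (scaledCoeff ι β x)).re := by
  funext x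
  rw [complexPartition_scaledCoeff, Complex.ofReal_re,
    ← Real.log_mul (by positivity) (by have := T.partitionFunction_pos β x; positivity),
    mul_inv_cancel_left₀ (by positivity), logPartition]

theorem complexPartition_scaledCoeff_re_pos (T : HamiltonianTerms N ι) (β : ℝ)
    (x : EuclideanSpace ℝ ι) :
    0 < (T.complexPartition Finset.univ (scaledCoeff ι β x)).re := by
  rw [complexPartition_scaledCoeff, Complex.ofReal_re]
  have := T.partitionFunction_pos β x
  positivity

theorem hasFDerivAt_re_comp_scaledCoeff {G : (ι → ℂ) → ℂ} (β : ℝ) {x : EuclideanSpace ℝ ι}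
    (hG : DifferentiableAt ℂ G (scaledCoeff ι β x)) :
    HasFDerivAt (fun y => (G (scaledCoeff ι β y)).re)
      (Complex.reCLM.comp (((fderiv ℂ G (scaledCoeff ι β x)).restrictScalars ℝ).comp
        (scaledCoeff ι β))) x :=
  Complex.reCLM.hasFDerivAt.comp x
    ((hG.hasFDerivAt.restrictScalars ℝ).comp x (scaledCoeff ι β).hasFDerivAt)

theorem contDiff_logPartition (T : HamiltonianTerms N ι) (β : ℝ) :
    ContDiff ℝ 2 (T.logPartition β) := by
  rw [logPartition_eq]
  refine contDiff_const.add (ContDiff.log ?_ fun x =>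
    (T.complexPartition_scaledCoeff_re_pos β x).ne')
  exact Complex.reCLM.contDiff.comp
    (((T.contDiff_complexPartition _).restrict_scalars ℝ).comp (scaledCoeff ι β).contDiff)

variable [DecidableEq ι]

theorem lineDeriv_logPartition (T : HamiltonianTerms N ι) (β : ℝ) (x : EuclideanSpace ℝ ι)
    (b : ι) :
    lineDeriv ℝ (T.logPartition β) x (EuclideanSpace.single b 1)
      = -β * (T.logDerivPartition b (scaledCoeff ι β x)).re := by
  have hdiff : Differentiable ℂ (T.complexPartition Finset.univ) :=
    (T.contDiff_complexPartition (n := 1) _).differentiable one_ne_zero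
  have h1 := ((hasFDerivAt_re_comp_scaledCoeff β (hdiff (scaledCoeff ι β x))).log
    (T.complexPartition_scaledCoeff_re_pos β x).ne').const_add (Real.log (2 ^ N))
  rw [← logPartition_eq] at h1
  rw [(h1.hasLineDerivAt _).lineDeriv, logDerivPartition, complexPartition_scaledCoeff,
    Complex.div_ofReal_re]
  simp only [_root_.smul_apply, ContinuousLinearMap.comp_apply,
    ContinuousLinearMap.coe_restrictScalars', scaledCoeff_single, map_smul, Complex.reCLM_apply,
    Complex.ofReal_re, smul_eq_mul]
  rw [← Complex.ofReal_neg, Complex.re_ofReal_mul]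
  ring

theorem hessianMatrix_logPartition (T : HamiltonianTerms N ι) (β : ℝ) (x : EuclideanSpace ℝ ι)
    (a b : ι) :
    hessianMatrix (T.logPartition β) x a b
      = β ^ 2 * (fderiv ℂ (T.logDerivPartition b) (scaledCoeff ι β x) (Pi.single a 1)).re := by
  rw [hessianMatrix, Matrix.of_apply]
  simp only [lineDeriv_logPartition]
  have hne : T.complexPartition Finset.univ (scaledCoeff ι β x) ≠ 0 := fun h => by
    have := T.complexPartition_scaledCoeff_re_pos β x
    rw [h, Complex.zero_re] at this
    exact this.false
  have h1 := (hasFDerivAt_re_comp_scaledCoeff β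
    (T.differentiableAt_logDerivPartition b hne)).const_mul (-β)
  rw [(h1.hasLineDerivAt _).lineDeriv]
  simp only [_root_.smul_apply, ContinuousLinearMap.comp_apply,
    ContinuousLinearMap.coe_restrictScalars', scaledCoeff_single, map_smul, Complex.reCLM_apply,
    smul_eq_mul]
  rw [← Complex.ofReal_neg, Complex.re_ofReal_mul]
  ring

/-- On the coefficient cube the Hessian quadratic form is within `β ^ 2 / 2` of `β ^ 2`. -/
theorem abs_sum_hessianMatrix_sub_le (T : HamiltonianTerms N ι) (hT : T.TracelessOrthonormal)
    {β : ℝ} (hβ : 0 < β) (hβd : 4096 * ((T.dualDegree : ℝ) + 1) ^ 5 * β ≤ 1)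
    {x : EuclideanSpace ℝ ι} (hx : x ∈ coefficientCube ι) (v : ι → ℝ) :
    |∑ a, ∑ b, v a * hessianMatrix (T.logPartition β) x a b * v b - β ^ 2 * ∑ a, v a ^ 2|
      ≤ β ^ 2 / 2 * ∑ a, v a ^ 2 := by
  have hC := T.contDiff_logPartition β
  have hscaled : ∀ a, ‖scaledCoeff ι β x a‖ ≤ β := fun a => by
    rw [scaledCoeff_apply, norm_mul, norm_neg, Complex.norm_real, Complex.norm_real,
      Real.norm_of_nonneg hβ.le, Real.norm_eq_abs]
    exact mul_le_of_le_one_right hβ.le (abs_le.2 (hx a))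
  have h := abs_sum_sum_mul_mul_le (c := β ^ 2 / 2)
    (A := fun a b => hessianMatrix (T.logPartition β) x a b - β ^ 2 * if a = b then 1 else 0)
    (fun a b => by simp only [hessianMatrix_symm hC x a b, eq_comm]) (fun b => by
      have h1 := T.sum_abs_re_fderiv_logDerivPartition_le hT hβ hβd hscaled b
      simp only [hessianMatrix_logPartition, ← mul_sub, abs_mul, abs_of_nonneg (sq_nonneg β),
        ← Finset.mul_sum]
      nlinarith [sq_nonneg β]) v
  convert h using 2
  simp only [mul_sub, sub_mul, Finset.sum_sub_distrib, mul_ite, ite_mul, mul_one, mul_zero,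
    zero_mul, Finset.sum_ite_eq, Finset.mem_univ, if_true]
  congr 1
  rw [Finset.mul_sum]
  exact Finset.sum_congr rfl fun a _ => by ring

end HamiltonianTerms

end LogPartition

theorem mainTheorem4 {N : ℕ} {ι : Type*} [Fintype ι] [DecidableEq ι]
    (T : HamiltonianTerms N ι) (hT : T.TracelessOrthonormal) (β : ℝ) (hβ : 0 < β)
    (hβd : 100 * Real.exp 1 ^ 6 * ((T.dualDegree : ℝ) + 1) ^ 8 * β ≤ 1) :
    ContDiff ℝ 2 (T.logPartition β) ∧
    StrongConvexOn (coefficientCube ι) (β ^ 2 / 2) (T.logPartition β) ∧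
    (∀ x ∈ coefficientCube ι,
      (hessianMatrix (T.logPartition β) x - (β ^ 2 / 2) • (1 : Matrix ι ι ℝ)).PosSemidef ∧
      ((3 * β ^ 2 / 2) • (1 : Matrix ι ι ℝ) - hessianMatrix (T.logPartition β) x).PosSemidef) ∧
    (Nonempty ι → ∀ m : ℝ, StrongConvexOn (coefficientCube ι) m (T.logPartition β) →
      m ≤ 3 * (β ^ 2 / 2)) := by
  have hC := T.contDiff_logPartition β
  have hβd' : 4096 * ((T.dualDegree : ℝ) + 1) ^ 5 * β ≤ 1 := by
    have h1 : (4096 : ℝ) ≤ 100 * Real.exp 1 ^ 6 := by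
      have h2 : (2 : ℝ) ≤ Real.exp 1 := by linarith [Real.add_one_le_exp 1]
      have h3 : (2 : ℝ) ^ 6 ≤ Real.exp 1 ^ 6 := pow_le_pow_left₀ zero_le_two h2 6
      linarith
    have h4 : ((T.dualDegree : ℝ) + 1) ^ 5 ≤ ((T.dualDegree : ℝ) + 1) ^ 8 :=
      pow_le_pow_right₀ (by simp) (by norm_num)
    refine le_trans ?_ hβd
    gcongr
  have hquad := fun x hx v => abs_le.1
    (T.abs_sum_hessianMatrix_sub_le hT hβ hβd' (x := x) hx v)
  have hsecond : ∀ x ∈ coefficientCube ι, ∀ v : EuclideanSpace ℝ ι,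
      β ^ 2 / 2 * ‖v‖ ^ 2 ≤ fderiv ℝ (fderiv ℝ (T.logPartition β)) x v v ∧
      fderiv ℝ (fderiv ℝ (T.logPartition β)) x v v ≤ 3 * (β ^ 2 / 2) * ‖v‖ ^ 2 := by
    intro x hx v
    have h := hquad x hx v
    rw [fderiv_fderiv_eq_sum_hessianMatrix hC, EuclideanSpace.real_norm_sq_eq]
    constructor <;> linarith [h.1, h.2]
  have hdot : ∀ (A : Matrix ι ι ℝ) (v : ι → ℝ),
      star v ⬝ᵥ A *ᵥ v = ∑ a, ∑ b, v a * A a b * v b := by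
    intro A v
    simp [dotProduct, Matrix.mulVec, Finset.mul_sum, mul_assoc]
  have hherm : ∀ x, (hessianMatrix (T.logPartition β) x).IsHermitian := fun x =>
    Matrix.IsHermitian.ext fun a b => by
      rw [star_trivial]
      exact hessianMatrix_symm hC x b a
  have hone : ∀ c : ℝ, (c • (1 : Matrix ι ι ℝ)).IsHermitian := fun c => by
    simp [Matrix.IsHermitian]
  have hdot_one : ∀ (c : ℝ) (v : ι → ℝ),
      star v ⬝ᵥ (c • (1 : Matrix ι ι ℝ)) *ᵥ v = c * ∑ a, v a ^ 2 := by
    intro c v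
    simp [Matrix.smul_mulVec, dotProduct, Finset.mul_sum, sq, mul_left_comm]
  refine ⟨hC, strongConvexOn_of_fderiv_fderiv hC (convex_coefficientCube ι)
    fun x hx v => (hsecond x hx v).1, fun x hx => ⟨?_, ?_⟩, fun hne m hm =>
      hm.le_of_fderiv_fderiv_le hC fun x hx v => (hsecond x hx v).2⟩
  · refine Matrix.PosSemidef.of_dotProduct_mulVec_nonneg ((hherm x).sub (hone _)) fun v => ?_
    rw [Matrix.sub_mulVec, dotProduct_sub, hdot_one, hdot]
    linarith [(hquad x hx v).1]
  · refine Matrix.PosSemidef.of_dotProduct_mulVec_nonneg ((hone _).sub (hherm x)) fun v => ?_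
    rw [Matrix.sub_mulVec, dotProduct_sub, hdot_one, hdot]
    linarith [(hquad x hx v).2]
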